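/- Let $H$ be a finite connected digraph that is transitive, antisymmetric and has all loops, i.e. a finite partially ordered set whose comparability graph is connected; write $u\le v$ when $(u,v)$ is an edge. An $H$-algebra is an algebra $A=\mathrm{span}\{e_{xy}: p(x)\le p(y)\}\subseteq M_\iota(\mathbb C)$, where $\iota$ is a finite set and $p:\iota\to H$ is surjective; $A(H)$ is the case $\iota=H$, $p=\mathrm{id}$. Then $A\otimes M_n$ is again an $H$-algebra (for $n \geq 1$). A (not necessarily unital) homomorphism $A\to A'$ of $H$-algebras is star-extendible if it is the restriction of a $*$-homomorphism $M_\iota(\mathbb C)\to M_{\iota'}(\mathbb C)$ of the generated C*-algebras; it has multiplicity one if this extension takes each $e_{xx}$ to a rank one projection; it is regular if it is an orthogonal direct sum of finitely many (possibly no) star-extendible maps of multiplicity one. Let $\mathcal F_H$ be the family of direct systems $\mathcal A=\{A_k,\alpha_k\}_{k\ge1}$ of $H$-algebras and regular star-extendible homomorphisms $\alpha_k:A_k\to A_{k+1}$ with $A_1=A(H)$. Systems $\mathcal A,\mathcal A'$ are regularly isomorphic if there are indices $1=n_0<n_1<\cdots$ and $m_0<m_1<\cdots$ and regular star-extendible maps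 $\phi_k:A_{n_k}\to A'_{m_k}$, $\psi_k:A'_{m_k}\to A_{n_{k+1}}$ such that all $\psi_k\circ\phi_k$ and $\phi_{k+1}\circ\psi_k$ are the maps of the systems. They are stably regularly isomorphic if the stable systems $\mathcal A^s=\{A_k\otimes M_k,\alpha_k\otimes i_k\}$ and $\mathcal A'^s$ are regularly isomorphic, where $i_k:M_k\to M_{k+1}$ is the corner inclusion. Let $V^r_H(\mathcal A)$ be the semigroup of classes $[\phi]$ of regular star-extendible maps $\phi:A(H)\to A_k\otimes M_n$ ($k,n$ arbitrary) under conjugation by unitaries of algebras $A_j\otimes M_N$, into which the maps are carried by the maps of the system and corner inclusions, with $[\phi]+[\psi]=[\phi\oplus\psi]$. Let $G^r_H(\mathcal A)$ be its Grothendieck group, ordered by the image $G^r_H(\mathcal A)_+$ of $V^r_H(\mathcal A)$. Its scale is the set of the classes of maps $A(H)\to A_k$. For an endomorphism $f$ of $H$ (a map with $u \leq v \Rightarrow f(u)\le f(v)$) let $\theta_f:A(H)\to A(H)\otimes M_{|H|}$, $e_{uv}\mapsto e_{f(u)f(v)}\otimes e_{uv}$. The multicone of $\mathcal A$ is the set of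 the tuples $([(\phi\otimes\mathrm{id})\circ\theta_f])_{f\in\mathrm{End}(H)}$ for regular star-extendible $\phi:A(H)\to A_k\otimes M_n$, with $k,n$ arbitrary; the multiscale of $\mathcal A$ is the set of those tuples for which $\phi$ maps into some $A_k$ itself. An isomorphism of such (scaled) ordered groups maps the positive cone (and the scale) onto the positive cone (and the scale); it preserves the multicone or multiscale if it maps it onto the other one. Theorem. Let $\mathcal A,\mathcal A'\in\mathcal F_H$. (1) $\mathcal A$ and $\mathcal A'$ are stably regularly isomorphic if and only if the scaled ordered groups $G^r_H(\mathcal A^s)$ and $G^r_H(\mathcal A'^s)$ of the stable systems are isomorphic by an isomorphism that preserves the multiscale. (2) Equivalently, $\mathcal A$ and $\mathcal A'$ are stably regularly isomorphic if and only if the ordered groups $G^r_H(\mathcal A)$ and $G^r_H(\mathcal A')$ are isomorphic by an isomorphism that preserves the multicone. (3) In particular, if the scaled ordered groups $G^r_H(\mathcal A)$ and $G^r_H(\mathcal A')$ are isomorphic by an isomorphism that preserves the multiscale, then $\mathcal A$ and $\mathcal A'$ are stably regularly isomorphic. -/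

import Mathlib

open scoped Matrix Kronecker

noncomputable section

namespace HSystem

/-!
A finite transitive antisymmetric digraph `H` (with all loops) is a finite partial order: there is
an edge `(u, v)` exactly when `u ≤ v`.
-/

section Homs

variable {H : Type} [PartialOrder H]

/-- A digraph algebra in `Matrix ι ι ℂ` with reduced digraph `H`. The index `x` lies in the block
of the vertex `p x`, and the algebra is the span of the matrix units `e_{xy}` with `p x ≤ p y`.
All vertices of `H` occur in the reduced digraph exactly when `p` is surjective, which is demanded
in `System.InF`. For `p = id : H → H` this is the triangular digraph algebra `A(H)`. -/
def alg {ι : Type} [Fintype ι] [DecidableEq ι] (p : ι → H) : Subalgebra ℂ (Matrix ι ι ℂ) where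
  carrier := {M | ∀ x y, ¬ p x ≤ p y → M x y = 0}
  mul_mem' := by
    intro M N hM hN x y hxy
    rw [Matrix.mul_apply]
    refine Finset.sum_eq_zero fun z _ => ?_
    by_cases h1 : p x ≤ p z
    · have h2 : ¬ p z ≤ p y := fun h2 => hxy (h1.trans h2)
      rw [hN z y h2, mul_zero]
    · rw [hM x z h1, zero_mul]
  add_mem' := by
    intro M N hM hN x y hxy
    rw [Matrix.add_apply, hM x y hxy, hN x y hxy, add_zero]
  algebraMap_mem' := by
    intro c x y hxy
    have hne : x ≠ y := by
      rintro rfl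
      exact hxy le_rfl
    rw [Matrix.algebraMap_matrix_apply, if_neg hne]

/-- The block labels of `A ⊗ M_n`: the algebra `alg (amp p n)` is `alg p ⊗ M_n`. -/
def amp {ι : Type} (p : ι → H) (n : ℕ) : ι × Fin n → H := fun x => p x.1

variable {ι κ : Type} [Fintype ι] [DecidableEq ι] [Fintype κ] [DecidableEq κ]

/-- `φ` is the restriction of a star homomorphism of the generated C*-algebras. For connected `H`
the C*-algebra generated by an `H`-algebra in `Matrix ι ι ℂ` is all of `Matrix ι ι ℂ`.
Homomorphisms need not be unital. -/
def StarExtendible {p : ι → H} {q : κ → H} (φ : alg p →ₙₐ[ℂ] alg q) : Prop :=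
  ∃ Φ : Matrix ι ι ℂ →⋆ₙₐ[ℂ] Matrix κ κ ℂ, ∀ a : alg p, Φ a = φ a

/-- Star-extendible maps of multiplicity one: the star extension takes the diagonal matrix
units to projections of rank one. -/
def MultOne {p : ι → H} {q : κ → H} (φ : alg p →ₙₐ[ℂ] alg q) : Prop :=
  ∃ Φ : Matrix ι ι ℂ →⋆ₙₐ[ℂ] Matrix κ κ ℂ,
    (∀ a : alg p, Φ a = φ a) ∧ ∀ x : ι, (Φ (Matrix.single x x 1)).rank = 1

/-- Regular star-extendible homomorphisms: orthogonal direct sums of finitely many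
star-extendible multiplicity one embeddings. The empty sum, the zero map, is allowed. -/
def IsRegular {p : ι → H} {q : κ → H} (φ : alg p →ₙₐ[ℂ] alg q) : Prop :=
  StarExtendible φ ∧
    ∃ (r : ℕ) (θ : Fin r → (alg p →ₙₐ[ℂ] alg q)),
      (∀ i, MultOne (θ i)) ∧
      (∀ i j, i ≠ j → ∀ a b : alg p, θ i a * θ j b = 0) ∧
      ∀ a : alg p, φ a = ∑ i, θ i a

/-- The `(c, d)` entry in `A` of an element of `A ⊗ M_n = M_n(A)`. -/
def entry {p : ι → H} {n : ℕ} (M : alg (amp p n)) (c d : Fin n) : alg p :=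
  ⟨fun x y => M.1 (x, c) (y, d), fun x y hxy => M.2 (x, c) (y, d) hxy⟩

theorem entry_add {p : ι → H} {n : ℕ} (M N : alg (amp p n)) (c d : Fin n) :
    entry (M + N) c d = entry M c d + entry N c d := rfl

theorem entry_smul {p : ι → H} {n : ℕ} (t : ℂ) (M : alg (amp p n)) (c d : Fin n) :
    entry (t • M) c d = t • entry M c d := rfl

theorem entry_mul {p : ι → H} {n : ℕ} (M N : alg (amp p n)) (c d : Fin n) :
    entry (M * N) c d = ∑ e, entry M c e * entry N e d := by
  apply Subtype.ext
  rw [AddSubmonoidClass.coe_finsetSum]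
  ext x y
  rw [Matrix.sum_apply]
  change (M.1 * N.1) (x, c) (y, d) = _
  rw [Matrix.mul_apply, Fintype.sum_prod_type_right]
  refine Finset.sum_congr rfl fun e _ => ?_
  rw [MulMemClass.coe_mul, Matrix.mul_apply]
  rfl

theorem kron_single_mem {q : κ → H} {m : ℕ} (b : alg q) (c d : Fin m) :
    b.1 ⊗ₖ Matrix.single c d (1 : ℂ) ∈ alg (amp q m) := by
  rintro ⟨x, c'⟩ ⟨y, d'⟩ hxy
  rw [Matrix.kronecker_apply, b.2 x y hxy, zero_mul]

/-- `φ ⊗ i : A ⊗ M_n → B ⊗ M_m`, where `i : M_n → M_m` is the inclusion as the upper left corner,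
that is, `∑ a_{cd} ⊗ e_{cd} ↦ ∑ φ(a_{cd}) ⊗ e_{cd}`. -/
def ampMap {p : ι → H} {q : κ → H} (φ : alg p →ₙₐ[ℂ] alg q) {n m : ℕ} (h : n ≤ m) :
    alg (amp p n) →ₙₐ[ℂ] alg (amp q m) where
  toFun M := ∑ c : Fin n, ∑ d : Fin n,
    ⟨(φ (entry M c d)).1 ⊗ₖ Matrix.single (Fin.castLE h c) (Fin.castLE h d) (1 : ℂ),
      kron_single_mem _ _ _⟩
  map_smul' := by
    intro t M
    apply Subtype.ext
    simp [entry_smul, Finset.smul_sum, Matrix.smul_kronecker]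
  map_zero' := by
    have h0 : ∀ c d : Fin n, entry (0 : alg (amp p n)) c d = 0 := fun _ _ => rfl
    apply Subtype.ext
    simp [h0]
  map_add' := by
    intro M N
    apply Subtype.ext
    simp [entry_add, Matrix.add_kronecker, Finset.sum_add_distrib]
  map_mul' := by
    intro M N
    apply Subtype.ext
    simp only [entry_mul, map_sum, map_mul, AddSubmonoidClass.coe_finsetSum, MulMemClass.coe_mul]
    have hs : ∀ (s : Fin n → Matrix κ κ ℂ) (B : Matrix (Fin m) (Fin m) ℂ),
        (∑ e, s e) ⊗ₖ B = ∑ e, s e ⊗ₖ B := by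
      intro s B
      ext x y
      simp [Matrix.sum_apply, Finset.sum_mul]
    simp only [hs, Finset.sum_mul, Finset.mul_sum, ← Matrix.mul_kronecker_mul]
    rw [Finset.sum_congr rfl fun c _ => Finset.sum_comm, Finset.sum_comm,
      Finset.sum_congr rfl fun e _ => Finset.sum_comm]
    refine Finset.sum_congr rfl fun e _ => Finset.sum_congr rfl fun d _ =>
      Finset.sum_congr rfl fun c _ => ?_
    rw [Finset.sum_eq_single e]
    · rw [Matrix.single_mul_single_same, one_mul]
    · intro e' _ hne
      rw [Matrix.single_mul_single_of_ne _ _ _ _ (fun hc => hne (Fin.castLE_injective h hc)),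
        Matrix.kronecker_zero]
    · exact fun hn => absurd (Finset.mem_univ e) hn

/-- The identification `(A ⊗ M_n) ⊗ M_K = A ⊗ M_{nK}`. -/
def flatten (p : ι → H) (n K : ℕ) :
    alg (amp (amp p n) K) →ₙₐ[ℂ] alg (amp p (n * K)) where
  toFun M := ⟨M.1.submatrix
      (((Equiv.refl ι).prodCongr finProdFinEquiv.symm).trans (Equiv.prodAssoc _ _ _).symm)
      (((Equiv.refl ι).prodCongr finProdFinEquiv.symm).trans (Equiv.prodAssoc _ _ _).symm),
    fun _ _ hxy => M.2 _ _ hxy⟩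
  map_smul' := fun _ _ => rfl
  map_zero' := rfl
  map_add' := fun _ _ => rfl
  map_mul' := by
    intro M N
    apply Subtype.ext
    exact (Matrix.submatrix_mul_equiv M.1 N.1 _ _ _).symm

/-- The multiplicity one embedding `θ_f : A(H) → A(H) ⊗ M_K`, `K = |H|`, of the digraph
endomorphism `f` of `H`, namely `e_{uv} ↦ e_{f(u) f(v)} ⊗ e_{uv}`. -/
def theta [Fintype H] [DecidableEq H] (f : H →o H) :
    alg (id : H → H) →ₙₐ[ℂ] alg (amp (id : H → H) (Fintype.card H)) where
  toFun M := ∑ u : H, ∑ v : H,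
    ⟨Matrix.single (f u) (f v) (M.1 u v) ⊗ₖ
        Matrix.single (Fintype.equivFin H u) (Fintype.equivFin H v) (1 : ℂ), by
      refine kron_single_mem ⟨Matrix.single (f u) (f v) (M.1 u v), ?_⟩ _ _
      intro x y hxy
      by_cases h : u ≤ v
      · refine Matrix.single_apply_of_ne _ _ _ _ _ ?_
        rintro ⟨rfl, rfl⟩
        exact hxy (f.monotone h)
      · rw [M.2 u v h, Matrix.single_zero, Matrix.zero_apply]⟩
  map_smul' := by
    intro t M
    apply Subtype.ext
    simp [Finset.smul_sum, ← Matrix.smul_kronecker, Matrix.smul_single]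
  map_zero' := by
    apply Subtype.ext
    simp
  map_add' := by
    intro M N
    apply Subtype.ext
    simp [Matrix.single_add, Matrix.add_kronecker, Finset.sum_add_distrib]
  map_mul' := by
    intro M N
    apply Subtype.ext
    simp only [AddSubmonoidClass.coe_finsetSum, MulMemClass.coe_mul, Finset.sum_mul,
      Finset.mul_sum, ← Matrix.mul_kronecker_mul]
    have hs : ∀ (u v : H) (B : Matrix (Fin (Fintype.card H)) (Fin (Fintype.card H)) ℂ),
        Matrix.single (f u) (f v) ((M.1 * N.1) u v) ⊗ₖ B =
          ∑ w, Matrix.single (f u) (f v) (M.1 u w * N.1 w v) ⊗ₖ B := by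
      intro u v B
      ext x y
      simp [Matrix.sum_apply, Matrix.mul_apply, Matrix.single_apply, Finset.sum_mul,
        Finset.sum_ite_irrel, ite_mul]
    simp only [hs]
    rw [Finset.sum_congr rfl fun c _ => Finset.sum_comm, Finset.sum_comm,
      Finset.sum_congr rfl fun e _ => Finset.sum_comm]
    refine Finset.sum_congr rfl fun w _ => Finset.sum_congr rfl fun v _ =>
      Finset.sum_congr rfl fun u _ => ?_
    rw [Finset.sum_eq_single w]
    · rw [Matrix.single_mul_single_same, Matrix.single_mul_single_same, one_mul]
    · intro w' _ hne
      rw [Matrix.single_mul_single_of_ne (1 : ℂ) (Fintype.equivFin H u) _ _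
        (fun hc => hne ((Fintype.equivFin H).injective hc)), Matrix.kronecker_zero]
    · exact fun hn => absurd (Finset.mem_univ w) hn

/-- `φ ∘ θ_f : A(H) → A ⊗ M_n ⊗ M_K = A ⊗ M_{nK}`, for `φ : A(H) → A ⊗ M_n`. -/
def compTheta [Fintype H] [DecidableEq H] {p : ι → H} {n : ℕ}
    (φ : alg (id : H → H) →ₙₐ[ℂ] alg (amp p n)) (f : H →o H) :
    alg (id : H → H) →ₙₐ[ℂ] alg (amp p (n * Fintype.card H)) :=
  (flatten p n (Fintype.card H)).comp ((ampMap φ le_rfl).comp (theta f))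

/-- `χ = φ ⊕ ψ`, block diagonally in `A ⊗ M_{n+m}`. -/
def IsDirectSum {p : ι → H} {q : κ → H} {n m : ℕ} (φ : alg q →ₙₐ[ℂ] alg (amp p n))
    (ψ : alg q →ₙₐ[ℂ] alg (amp p m)) (χ : alg q →ₙₐ[ℂ] alg (amp p (n + m))) : Prop :=
  ∀ a : alg q,
    (χ a).1 =
      Matrix.reindex
        ((Equiv.prodSumDistrib ι (Fin n) (Fin m)).symm.trans
          ((Equiv.refl ι).prodCongr finSumFinEquiv))
        ((Equiv.prodSumDistrib ι (Fin n) (Fin m)).symm.trans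
          ((Equiv.refl ι).prodCongr finSumFinEquiv))
        (Matrix.fromBlocks (φ a).1 0 0 (ψ a).1)

end Homs

/-- A direct system `A_0 → A_1 → A_2 → ⋯` of digraph algebras `A_k = alg (p k)` in
`Matrix (ι k) (ι k) ℂ` and algebra homomorphisms. -/
structure System (H : Type) [PartialOrder H] where
  ι : ℕ → Type
  [fintype : ∀ k, Fintype (ι k)]
  [deq : ∀ k, DecidableEq (ι k)]
  p : ∀ k, ι k → H
  map : ∀ k, alg (p k) →ₙₐ[ℂ] alg (p (k + 1))

attribute [instance] System.fintype System.deq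

section Systems

variable {H : Type} [PartialOrder H]

/-- The family `F_H`: regular star-extendible systems of `H`-algebras, the first of which is
`A(H)` (each of its blocks has size one). -/
def System.InF (S : System H) : Prop :=
  Function.Bijective (S.p 0) ∧ (∀ k, Function.Surjective (S.p k)) ∧ ∀ k, IsRegular (S.map k)

/-- The composed maps `A_k → A_j`, `k ≤ j`, of the system. -/
def System.trans (S : System H) {k j : ℕ} (h : k ≤ j) : alg (S.p k) →ₙₐ[ℂ] alg (S.p j) :=
  Nat.leRec (motive := fun j _ => alg (S.p k) →ₙₐ[ℂ] alg (S.p j))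
    (NonUnitalAlgHom.id ℂ (alg (S.p k))) (fun j _ f => (S.map j).comp f) h

/-- The stable system `{A_k ⊗ M_k, α_k ⊗ i_k}`; the numbering of systems starts with `0` here,
that of the matrix algebras with `M_1`. -/
def System.stable (S : System H) : System H where
  ι k := S.ι k × Fin (k + 1)
  p k := amp (S.p k) (k + 1)
  map k := ampMap (S.map k) (Nat.le_succ (k + 1))

/-- Regular isomorphism of systems: there are regular star-extendible maps
`A_{n_0} → A'_{m_0} → A_{n_1} → A'_{m_1} → ⋯`, `n_0 = 0`, that commute with the maps of the
systems. -/
def RegIso (S T : System H) : Prop :=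
  ∃ (n m : ℕ → ℕ) (hn : StrictMono n) (hm : StrictMono m)
    (φ : ∀ k, alg (S.p (n k)) →ₙₐ[ℂ] alg (T.p (m k)))
    (ψ : ∀ k, alg (T.p (m k)) →ₙₐ[ℂ] alg (S.p (n (k + 1)))),
    n 0 = 0 ∧ (∀ k, IsRegular (φ k)) ∧ (∀ k, IsRegular (ψ k)) ∧
    (∀ k, (ψ k).comp (φ k) = S.trans (hn.monotone (Nat.le_succ k))) ∧
    ∀ k, (φ (k + 1)).comp (ψ k) = T.trans (hm.monotone (Nat.le_succ k))

/-- Stable regular isomorphism: regular isomorphism of the stable systems. -/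
def StablyRegIso (S T : System H) : Prop := RegIso S.stable T.stable

variable [Fintype H] [DecidableEq H]

/-- Regular star-extendible maps `A(H) → 𝒜 ⊗ M_∞`, that is, `A(H) → A_k ⊗ M_n` for some
`k` and `n`. -/
structure Rep (S : System H) where
  k : ℕ
  n : ℕ
  φ : alg (id : H → H) →ₙₐ[ℂ] alg (amp (S.p k) n)
  reg : IsRegular φ

/-- Equivalence by a unitary of some `A_j ⊗ M_N`, into which both maps are carried by the maps
of the system and the corner inclusions. -/
def Rep.Equivalent {S : System H} (a b : Rep S) : Prop :=
  ∃ (j N : ℕ) (hak : a.k ≤ j) (han : a.n ≤ N) (hbk : b.k ≤ j) (hbn : b.n ≤ N)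
    (u : Matrix (S.ι j × Fin N) (S.ι j × Fin N) ℂ),
    u ∈ alg (amp (S.p j) N) ∧ u ∈ Matrix.unitaryGroup (S.ι j × Fin N) ℂ ∧
    ∀ x : alg (id : H → H),
      u * (ampMap (S.trans hak) han (a.φ x)).1 * uᴴ = (ampMap (S.trans hbk) hbn (b.φ x)).1

/-- `V^r_H(𝒜)`, the equivalence classes of regular star-extendible maps `A(H) → 𝒜 ⊗ M_∞`. -/
def V (S : System H) : Type := Quot (Rep.Equivalent (S := S))

/-- The relations `[φ ⊕ ψ] = [φ] + [ψ]`. As a map into `A_k ⊗ M_n` is equivalent to its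
composition with `A_k ⊗ M_n → A_j ⊗ M_n`, it is enough to add maps into the same `A_k`. -/
def sumRelations (S : System H) : Set (FreeAbelianGroup (V S)) :=
  {g | ∃ (k n m : ℕ) (φ : alg (id : H → H) →ₙₐ[ℂ] alg (amp (S.p k) n))
      (ψ : alg (id : H → H) →ₙₐ[ℂ] alg (amp (S.p k) m))
      (χ : alg (id : H → H) →ₙₐ[ℂ] alg (amp (S.p k) (n + m)))
      (hφ : IsRegular φ) (hψ : IsRegular ψ) (hχ : IsRegular χ),
      IsDirectSum φ ψ χ ∧
      g = FreeAbelianGroup.of (Quot.mk _ ⟨k, n + m, χ, hχ⟩ : V S) -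
        (FreeAbelianGroup.of (Quot.mk _ ⟨k, n, φ, hφ⟩ : V S) +
          FreeAbelianGroup.of (Quot.mk _ ⟨k, m, ψ, hψ⟩ : V S))}

/-- The regular Grothendieck group `G^r_H(𝒜)`: the Grothendieck group of `V^r_H(𝒜)` under
direct sum. -/
abbrev G (S : System H) : Type :=
  FreeAbelianGroup (V S) ⧸ AddSubgroup.closure (sumRelations S)

/-- The class `[φ]` in `G^r_H(𝒜)`. -/
def cls {S : System H} (a : Rep S) : G S :=
  QuotientAddGroup.mk (FreeAbelianGroup.of (Quot.mk _ a : V S))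

/-- The positive cone of `G^r_H(𝒜)`, the image of `V^r_H(𝒜)`. -/
def posCone (S : System H) : Set (G S) := Set.range cls

/-- The scale: the classes of the maps into `𝒜` itself, that is, into some
`A_k = A_k ⊗ M_1`. -/
def scale (S : System H) : Set (G S) := {g | ∃ a : Rep S, a.n = 1 ∧ g = cls a}

/-- `g` is the tuple `([φ ∘ θ_f])`, `f` running through the endomorphisms of `H`. -/
def IsMultiClass {S : System H} (a : Rep S) (g : (H →o H) → G S) : Prop :=
  ∀ f : H →o H, ∃ h : IsRegular (compTheta a.φ f),
    g f = cls ⟨a.k, a.n * Fintype.card H, compTheta a.φ f, h⟩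

/-- The multicone: the tuples `([φ ∘ θ_f])` for `φ : A(H) → 𝒜 ⊗ M_∞`. -/
def multicone (S : System H) : Set ((H →o H) → G S) :=
  {g | ∃ a : Rep S, IsMultiClass a g}

/-- The multiscale: the tuples `([φ ∘ θ_f])` for `φ : A(H) → 𝒜`. -/
def multiscale (S : System H) : Set ((H →o H) → G S) :=
  {g | ∃ a : Rep S, a.n = 1 ∧ IsMultiClass a g}

/-- The ordered groups are isomorphic by an isomorphism that preserves the multicone. -/
def MulticoneIso (S T : System H) : Prop :=
  ∃ γ : G S ≃+ G T, γ '' posCone S = posCone T ∧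
    (fun g f => γ (g f)) '' multicone S = multicone T

/-- The scaled ordered groups are isomorphic by an isomorphism that preserves the
multiscale. -/
def MultiscaleIso (S T : System H) : Prop :=
  ∃ γ : G S ≃+ G T, γ '' posCone S = posCone T ∧ γ '' scale S = scale T ∧
    (fun g f => γ (g f)) '' multiscale S = multiscale T

end Systems

end HSystem

end

noncomputable section

set_option linter.unusedSectionVars false
set_option linter.unusedSimpArgs false

namespace HSystem

/-! A regular map is classified up to unitaries by its type, a sum of endomorphisms in `ℤ[End H]`.
The star extension of a multiplicity one map is spatial, and membership in the target algebra makes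
the implementing isometry send the block of `u` into the block of `f u` for one endomorphism `f`
(`IsRegular.exists_hasType`). A commutant argument, using connectedness, shows that the type is well
defined (`HasType.unique`). Equal types give maps conjugate by a unitary of the target algebra
(`HasType.exists_unitary`). Types multiply under composition and add under direct sums.

Hence a system is encoded by its sequence `a k` of types, and its Grothendieck group is the limit of
copies of `ℤ[End H]` under left multiplication by the `a k` (`exists_equiv_lim`). Composition with
`θ_f` multiplies types by `f` on the right. So the limit is a right `ℤ[End H]`-module, and the tuple
of `φ` is `([φ] · f)_f`. Preserving the tuples makes a group isomorphism linear
(`limIso_of_addEquiv`).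

Everything therefore reduces to `LimIso`, an isomorphism of the limits as ordered modules. From it a
regular isomorphism of the stable systems is built back and forth: linearity makes each triangle
commute on types at a late stage, and a unitary makes it commute exactly (`exists_backward`). The
stable algebras have room for every positive type. Conversely, commuting triangles are equations
between types (`RegIso.limIso`). Amplification does not change types, so the system and its stable
system have the same limit. -/

/-! ### Maps implemented by graded isometries -/

section Implemented

variable {H : Type} [PartialOrder H]
variable {ι κ R : Type} [Fintype ι] [DecidableEq ι] [Fintype κ] [DecidableEq κ]
  [Fintype R] [DecidableEq R]

/-- `W` is an isometry `⨁_{i ∈ R} ℂ^ι → ℂ^κ` that maps the block of `u` in the summand `i` into the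
block of `f i u`. -/
structure GradedIsometry (p : ι → H) (q : κ → H) (f : R → H →o H) (W : Matrix κ (R × ι) ℂ) :
    Prop where
  isometry : Wᴴ * W = 1
  graded : ∀ y i x, W y (i, x) ≠ 0 → q y = f i (p x)

variable {p : ι → H} {q : κ → H} {f : R → H →o H} {W : Matrix κ (R × ι) ℂ}

/-- A nonzero entry at `(y, y')` comes from one summand `i` and indices with `p x ≤ p x'`, and `f i`
is monotone. -/
theorem GradedIsometry.conj_mem (hW : GradedIsometry p q f W) (a : alg p) :
    W * ((1 : Matrix R R ℂ) ⊗ₖ a.1) * Wᴴ ∈ alg q := by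
  intro y y' hy
  rw [Matrix.mul_apply]
  refine Finset.sum_eq_zero fun c' _ => ?_
  rw [Matrix.mul_apply, Finset.sum_mul]
  refine Finset.sum_eq_zero fun c _ => ?_
  obtain ⟨i, x⟩ := c
  obtain ⟨i', x'⟩ := c'
  by_contra hne
  have h1 : W y (i, x) ≠ 0 := fun h => hne (by rw [h]; ring)
  have h2 : W y' (i', x') ≠ 0 := fun h => hne (by simp [Matrix.conjTranspose_apply, h])
  have h3 : i = i' := by
    by_contra h
    exact hne (by simp [Matrix.one_apply, h])
  have h4 : p x ≤ p x' := by
    by_contra h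
    exact hne (by simp [a.2 x x' h])
  subst h3
  rw [hW.graded y i x h1, hW.graded y' i x' h2] at hy
  exact hy ((f i).monotone h4)

theorem one_kronecker_mul (a b : Matrix ι ι ℂ) :
    (1 : Matrix R R ℂ) ⊗ₖ (a * b) = ((1 : Matrix R R ℂ) ⊗ₖ a) * ((1 : Matrix R R ℂ) ⊗ₖ b) := by
  rw [← Matrix.mul_kronecker_mul, one_mul]

theorem conj_mul_conj {ρ σ : Type} [Fintype ρ] [DecidableEq ρ] [Fintype σ] {U : Matrix σ ρ ℂ}
    (h : Uᴴ * U = 1) (a b : Matrix ρ ρ ℂ) :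
    U * a * Uᴴ * (U * b * Uᴴ) = U * (a * b) * Uᴴ := by
  calc U * a * Uᴴ * (U * b * Uᴴ) = U * a * (Uᴴ * U) * b * Uᴴ := by simp only [Matrix.mul_assoc]
    _ = _ := by rw [h, Matrix.mul_one]; simp only [Matrix.mul_assoc]

/-- The homomorphism implemented by a graded isometry. -/
def GradedIsometry.hom (hW : GradedIsometry p q f W) : alg p →ₙₐ[ℂ] alg q where
  toFun a := ⟨W * ((1 : Matrix R R ℂ) ⊗ₖ a.1) * Wᴴ, hW.conj_mem a⟩
  map_smul' t a := by
    apply Subtype.ext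
    simp [Matrix.kronecker_smul]
  map_zero' := by
    apply Subtype.ext
    simp
  map_add' a b := by
    apply Subtype.ext
    simp [Matrix.kronecker_add, Matrix.mul_add, Matrix.add_mul]
  map_mul' a b := by
    apply Subtype.ext
    simp only [MulMemClass.coe_mul, one_kronecker_mul]
    exact (conj_mul_conj hW.isometry _ _).symm

/-- The star homomorphism `a ↦ U (1 ⊗ a) Uᴴ` of full matrix algebras. -/
def starConj (U : Matrix κ (R × ι) ℂ) (hU : Uᴴ * U = 1) :
    Matrix ι ι ℂ →⋆ₙₐ[ℂ] Matrix κ κ ℂ where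
  toFun a := U * ((1 : Matrix R R ℂ) ⊗ₖ a) * Uᴴ
  map_smul' t a := by
    simp [Matrix.kronecker_smul]
  map_zero' := by
    simp
  map_add' a b := by
    simp [Matrix.kronecker_add, Matrix.mul_add, Matrix.add_mul]
  map_mul' a b := by
    rw [one_kronecker_mul]
    exact (conj_mul_conj hU _ _).symm
  map_star' a := by
    simp only [Matrix.star_eq_conjTranspose, Matrix.conjTranspose_mul,
      Matrix.conjTranspose_conjTranspose, Matrix.conjTranspose_kronecker,
      Matrix.conjTranspose_one, Matrix.mul_assoc]

/-- `φ` is unitarily equivalent to an orthogonal sum of multiplicity one maps of the endomorphisms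
`f i`, and `m = ∑ f i` in `ℤ[End H]`. -/
def HasType (φ : alg p →ₙₐ[ℂ] alg q) (m : MonoidAlgebra ℤ (H →o H)) : Prop :=
  ∃ (R : Type) (_ : Fintype R) (_ : DecidableEq R) (f : R → H →o H) (W : Matrix κ (R × ι) ℂ),
    GradedIsometry p q f W ∧ (∀ a, (φ a).1 = W * ((1 : Matrix R R ℂ) ⊗ₖ a.1) * Wᴴ) ∧
    m = ∑ i, MonoidAlgebra.of ℤ (H →o H) (f i)

theorem GradedIsometry.hasType_hom (hW : GradedIsometry p q f W) :
    HasType hW.hom (∑ i, MonoidAlgebra.of ℤ (H →o H) (f i)) :=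
  ⟨R, _, _, f, W, hW, fun _ => rfl, rfl⟩

/-- The part of `W` on the summand `i`. -/
def component (W : Matrix κ (R × ι) ℂ) (i : R) : Matrix κ (Unit × ι) ℂ := fun y c => W y (i, c.2)

theorem component_conjTranspose_mul (hW : Wᴴ * W = 1) (i j : R) :
    (component W i)ᴴ * component W j = if i = j then 1 else 0 := by
  ext ⟨_, x⟩ ⟨_, x'⟩
  have h := congrFun (congrFun hW (i, x)) (j, x')
  rw [Matrix.mul_apply] at h ⊢
  simp only [Matrix.conjTranspose_apply] at h
  simp only [Matrix.conjTranspose_apply, component, h]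
  by_cases hij : i = j
  · subst hij
    simp [Matrix.one_apply]
  · simp [hij, Matrix.one_apply]

theorem GradedIsometry.component (hW : GradedIsometry p q f W) (i : R) :
    GradedIsometry p q (fun _ : Unit => f i) (component W i) where
  isometry := by rw [component_conjTranspose_mul hW.isometry, if_pos rfl]
  graded y _ x h := hW.graded y i x h

theorem conj_eq_sum_component (W : Matrix κ (R × ι) ℂ) (a : Matrix ι ι ℂ) :
    W * ((1 : Matrix R R ℂ) ⊗ₖ a) * Wᴴ =
      ∑ i, component W i * ((1 : Matrix Unit Unit ℂ) ⊗ₖ a) * (component W i)ᴴ := by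
  ext y y'
  simp only [Matrix.mul_apply, Matrix.sum_apply, Fintype.sum_prod_type, Matrix.conjTranspose_apply,
    component, Matrix.kronecker_apply, Matrix.one_apply]
  refine Finset.sum_congr rfl fun i _ => ?_
  simp

/-- The image is the outer product of column `x` of `U` with its conjugate, and compressing by `U`
recovers the matrix unit, so it is not zero. -/
theorem rank_starConj_unit (U : Matrix κ (Unit × ι) ℂ) (hU : Uᴴ * U = 1) (x : ι) :
    (starConj U hU (Matrix.single x x 1)).rank = 1 := by
  have h1 : starConj U hU (Matrix.single x x 1) =
      Matrix.vecMulVec (fun y => U y ((), x)) (fun y => star (U y ((), x))) := by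
    ext y y'
    change (U * ((1 : Matrix Unit Unit ℂ) ⊗ₖ (Matrix.single x x 1 : Matrix ι ι ℂ)) * Uᴴ :
      Matrix κ κ ℂ) y y' = _
    simp [Matrix.mul_apply, Fintype.sum_prod_type, Matrix.vecMulVec_apply, Matrix.single_apply,
      Matrix.one_apply, ite_and]
  have h2 : starConj U hU (Matrix.single x x 1) ≠ 0 := by
    intro h
    have h3 : Uᴴ * (starConj U hU (Matrix.single x x 1)) * U = 0 := by rw [h]; simp
    have h4 : Uᴴ * (starConj U hU (Matrix.single x x 1)) * U =
        (1 : Matrix Unit Unit ℂ) ⊗ₖ Matrix.single x x 1 := by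
      change Uᴴ * (U * ((1 : Matrix Unit Unit ℂ) ⊗ₖ Matrix.single x x 1) * Uᴴ) * U = _
      calc _ = (Uᴴ * U) * ((1 : Matrix Unit Unit ℂ) ⊗ₖ Matrix.single x x 1) * (Uᴴ * U) := by
            simp only [Matrix.mul_assoc]
        _ = _ := by rw [hU, Matrix.one_mul, Matrix.mul_one]
    rw [h3] at h4
    have := congrFun (congrFun h4 ((), x)) ((), x)
    simp at this
  refine le_antisymm ?_ ?_
  · rw [h1]
    exact Matrix.rank_vecMulVec_le _ _
  · rw [Nat.one_le_iff_ne_zero, Ne, Matrix.rank, Submodule.finrank_eq_zero, LinearMap.range_eq_bot]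
    intro h3
    exact h2 (Matrix.mulVec_injective (funext fun v => by simpa using LinearMap.congr_fun h3 v))

/-- Splitting `W` into the columns of the single summands gives the multiplicity one maps; they are
orthogonal because the column spaces are. -/
theorem HasType.isRegular {φ : alg p →ₙₐ[ℂ] alg q} {m : MonoidAlgebra ℤ (H →o H)}
    (h : HasType φ m) : IsRegular φ := by
  obtain ⟨R, _, _, f, W, hW, hφ, -⟩ := h
  refine ⟨⟨starConj W hW.isometry, fun a => (hφ a).symm⟩, Fintype.card R,
    fun i => (hW.component ((Fintype.equivFin R).symm i)).hom, ?_, ?_, ?_⟩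
  · intro i
    exact ⟨starConj _ (hW.component _).isometry, fun a => rfl, rank_starConj_unit _ _⟩
  · intro i j hij a b
    apply Subtype.ext
    change (component W _ * _ * (component W _)ᴴ) * (component W _ * _ * (component W _)ᴴ) = 0
    have h0 := component_conjTranspose_mul hW.isometry ((Fintype.equivFin R).symm i)
      ((Fintype.equivFin R).symm j)
    rw [if_neg (fun h => hij ((Fintype.equivFin R).symm.injective h))] at h0
    rw [Matrix.mul_assoc, ← Matrix.mul_assoc (component W _)ᴴ,
      ← Matrix.mul_assoc (component W _)ᴴ, h0]
    simp
  · intro a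
    apply Subtype.ext
    rw [hφ, conj_eq_sum_component, AddSubmonoidClass.coe_finsetSum]
    exact ((Fintype.equivFin R).symm.sum_comp fun i =>
      component W i * ((1 : Matrix Unit Unit ℂ) ⊗ₖ a.1) * (component W i)ᴴ).symm

end Implemented

/-! ### Regular maps are implemented by graded isometries -/

section RegularForm

variable {H : Type} [PartialOrder H]
variable {ι κ : Type} [Fintype ι] [DecidableEq ι] [Fintype κ] [DecidableEq κ]

theorem exists_column_mul_row_of_rank_eq_one {P : Matrix κ κ ℂ} (h : P.rank = 1) :
    ∃ (v : Matrix κ Unit ℂ) (c : Matrix Unit κ ℂ), P = v * c := by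
  rw [Matrix.rank, finrank_eq_one_iff'] at h
  obtain ⟨v, -, hv⟩ := h
  choose c hc using fun y' : κ => hv ⟨P *ᵥ Pi.single y' 1, ⟨Pi.single y' 1, rfl⟩⟩
  refine ⟨Matrix.of fun y _ => v.1 y, Matrix.of fun _ y' => c y', ?_⟩
  ext y y'
  have h1 := congrFun (congrArg Subtype.val (hc y')) y
  simp only [Matrix.mulVec_single_one] at h1
  rw [Matrix.mul_apply]
  simp only [Finset.univ_unique, Finset.sum_singleton, Matrix.of_apply]
  rw [mul_comm]
  exact h1.symm

theorem unit_matrix_eq_smul_one (s : Matrix Unit Unit ℂ) :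
    s = s () () • (1 : Matrix Unit Unit ℂ) := by
  ext
  simp

/-- With `P = v c`, self-adjointness and idempotency give `P = P Pᴴ = v (c cᴴ) vᴴ`, where `c cᴴ` is
a scalar `t ≥ 0`. So `√t • v` works. -/
theorem exists_unit_column_of_rank_one_projection {P : Matrix κ κ ℂ} (hs : Pᴴ = P) (hi : P * P = P)
    (h : P.rank = 1) : ∃ η : Matrix κ Unit ℂ, P = η * ηᴴ ∧ ηᴴ * η = 1 := by
  obtain ⟨v, c, hP⟩ := exists_column_mul_row_of_rank_eq_one h
  have hP0 : P ≠ 0 := by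
    rintro rfl
    simp at h
  set t : ℝ := ∑ y, ‖c () y‖ ^ 2 with ht
  have ht0 : 0 ≤ t := Finset.sum_nonneg fun _ _ => sq_nonneg _
  have hcc : c * cᴴ = (t : ℂ) • (1 : Matrix Unit Unit ℂ) := by
    rw [unit_matrix_eq_smul_one (c * cᴴ)]
    congr 1
    simp [Matrix.mul_apply, ht, Complex.mul_conj, Complex.normSq_eq_norm_sq]
  have hη : P = (((Real.sqrt t : ℝ) : ℂ) • v) * (((Real.sqrt t : ℝ) : ℂ) • v)ᴴ := by
    have hsq : ((Real.sqrt t : ℝ) : ℂ) * ((Real.sqrt t : ℝ) : ℂ) = (t : ℂ) := by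
      rw [← Complex.ofReal_mul, Real.mul_self_sqrt ht0]
    calc P = P * Pᴴ := by rw [hs, hi]
      _ = v * (c * cᴴ) * vᴴ := by rw [hP, Matrix.conjTranspose_mul]; simp only [Matrix.mul_assoc]
      _ = _ := by
        rw [hcc]
        rw [Matrix.conjTranspose_smul, Matrix.mul_smul, Matrix.mul_one, Matrix.smul_mul,
          Matrix.smul_mul, Matrix.mul_smul, smul_smul, RCLike.star_def, Complex.conj_ofReal, hsq]
  refine ⟨((Real.sqrt t : ℝ) : ℂ) • v, hη, ?_⟩
  generalize ((Real.sqrt t : ℝ) : ℂ) • v = η at hη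
  -- Idempotency of `P = η ηᴴ` says that the scalar `ηᴴ η` fixes the nonzero matrix `P`, so it is
  -- `1`.
  have h1 : (ηᴴ * η) () () • P = P := by
    calc (ηᴴ * η) () () • P = η * ((ηᴴ * η) () () • (1 : Matrix Unit Unit ℂ)) * ηᴴ := by
          rw [Matrix.mul_smul, Matrix.mul_one, Matrix.smul_mul, ← hη]
      _ = P * P := by
          rw [← unit_matrix_eq_smul_one, hη]
          simp only [Matrix.mul_assoc]
      _ = P := hi
  have h2 : (ηᴴ * η) () () = 1 := by
    by_contra hne
    have : ((ηᴴ * η) () () - 1) • P = 0 := by rw [sub_smul, h1, one_smul, sub_self]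
    rcases smul_eq_zero.mp this with h3 | h3
    · exact hne (sub_eq_zero.mp h3)
    · exact hP0 h3
  rw [unit_matrix_eq_smul_one (ηᴴ * η), h2, one_smul]

theorem starHom_apply_eq_sum (Φ : Matrix ι ι ℂ →⋆ₙₐ[ℂ] Matrix κ κ ℂ) (a : Matrix ι ι ℂ) :
    Φ a = ∑ x, ∑ x', a x x' • Φ (Matrix.single x x' 1) := by
  conv_lhs => rw [Matrix.matrix_eq_sum_single a]
  simp only [map_sum]
  refine Finset.sum_congr rfl fun x _ => Finset.sum_congr rfl fun x' _ => ?_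
  rw [← map_smul, Matrix.smul_single, smul_eq_mul, mul_one]

/-- A star homomorphism that maps minimal projections to rank one projections is spatial. -/
theorem exists_isometry_of_rank_one [Nonempty ι] (Φ : Matrix ι ι ℂ →⋆ₙₐ[ℂ] Matrix κ κ ℂ)
    (hr : ∀ x : ι, (Φ (Matrix.single x x 1)).rank = 1) :
    ∃ U : Matrix κ (Unit × ι) ℂ, Uᴴ * U = 1 ∧
      (∀ a, Φ a = U * ((1 : Matrix Unit Unit ℂ) ⊗ₖ a) * Uᴴ) ∧
      ∀ x x' y y', Φ (Matrix.single x x' 1) y y' = U y ((), x) * star (U y' ((), x')) := by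
  obtain ⟨x₀⟩ := ‹Nonempty ι›
  have hstar : ∀ x x' : ι, (Φ (Matrix.single x x' 1))ᴴ = Φ (Matrix.single x' x 1) := by
    intro x x'
    rw [← Matrix.star_eq_conjTranspose, ← map_star, Matrix.star_eq_conjTranspose,
      Matrix.conjTranspose_single, star_one]
  have hmul : ∀ x y z : ι, Φ (Matrix.single x y 1) * Φ (Matrix.single y z 1) =
      Φ (Matrix.single x z 1) := by
    intro x y z
    rw [← map_mul, Matrix.single_mul_single_same, one_mul]
  obtain ⟨η, hη, hη1⟩ := exists_unit_column_of_rank_one_projection (hstar x₀ x₀) (hmul x₀ x₀ x₀)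
    (hr x₀)
  -- The columns of `U`: a unit vector of the range of one minimal projection, moved to the others
  -- by the images of the matrix units.
  let ξ : ι → Matrix κ Unit ℂ := fun x => Φ (Matrix.single x x₀ 1) * η
  have hξ : ∀ x x', ξ x * (ξ x')ᴴ = Φ (Matrix.single x x' 1) := by
    intro x x'
    change Φ (Matrix.single x x₀ 1) * η * (Φ (Matrix.single x' x₀ 1) * η)ᴴ = _
    rw [Matrix.conjTranspose_mul, hstar, Matrix.mul_assoc, ← Matrix.mul_assoc η, ← hη, hmul, hmul]
  have hξ1 : ∀ x x', (ξ x)ᴴ * ξ x' = if x = x' then 1 else 0 := by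
    intro x x'
    change (Φ (Matrix.single x x₀ 1) * η)ᴴ * (Φ (Matrix.single x' x₀ 1) * η) = _
    rw [Matrix.conjTranspose_mul, hstar, Matrix.mul_assoc, ← Matrix.mul_assoc (Φ _)]
    split_ifs with h
    · subst h
      rw [hmul, hη, Matrix.mul_assoc, hη1, Matrix.mul_one, hη1]
    · rw [← map_mul, Matrix.single_mul_single_of_ne _ _ _ _ h]
      simp
  refine ⟨Matrix.of fun y c => ξ c.2 y (), ?_, ?_, ?_⟩
  · ext ⟨_, x⟩ ⟨_, x'⟩
    have h := congrFun (congrFun (hξ1 x x') ()) ()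
    rw [Matrix.mul_apply] at h ⊢
    simp only [Matrix.conjTranspose_apply, Matrix.of_apply] at h ⊢
    rw [h]
    split_ifs with h'
    · simp [h', Matrix.one_apply]
    · simp [h', Matrix.one_apply]
  · intro a
    rw [starHom_apply_eq_sum Φ a]
    ext y y'
    simp only [← hξ, Matrix.sum_apply, Matrix.mul_apply, Matrix.smul_apply, Fintype.sum_prod_type,
      Finset.univ_unique, Finset.sum_singleton, Matrix.kronecker_apply, Matrix.one_apply,
      Matrix.conjTranspose_apply, Finset.sum_mul, smul_eq_mul, if_true, one_mul, Matrix.of_apply]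
    rw [Finset.sum_comm]
    refine Finset.sum_congr rfl fun x _ => Finset.sum_congr rfl fun x' _ => ?_
    simp
    ring
  · intro x x' y y'
    rw [← hξ]
    simp [Matrix.mul_apply]

theorem single_mem_alg {p : ι → H} {x x' : ι} (h : p x ≤ p x') :
    Matrix.single x x' (1 : ℂ) ∈ alg p := by
  intro y y' hy
  refine Matrix.single_apply_of_ne _ _ _ _ _ ?_
  rintro ⟨rfl, rfl⟩
  exact hy h

/-- The entries of the image of `e_{xx'}` are products of entries of columns `x` and `x'`. Hence `p
x ≤ p x'` forces `q y ≤ q y'` for all `y`, `y'` in the supports of these columns. By antisymmetry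
`q` is constant on the supports over one vertex, which defines a monotone `f`. -/
theorem MultOne.exists_gradedIsometry [Nonempty H] {p : ι → H} {q : κ → H}
    (hp : Function.Surjective p) {φ : alg p →ₙₐ[ℂ] alg q} (h : MultOne φ) :
    ∃ (f : H →o H) (U : Matrix κ (Unit × ι) ℂ), GradedIsometry p q (fun _ => f) U ∧
      ∀ a, (φ a).1 = U * ((1 : Matrix Unit Unit ℂ) ⊗ₖ a.1) * Uᴴ := by
  obtain ⟨Φ, hΦ, hr⟩ := h
  have : Nonempty ι := (hp (Classical.arbitrary H)).nonempty
  obtain ⟨U, hU, hΦU, hent⟩ := exists_isometry_of_rank_one Φ hr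
  have hle : ∀ x x' y y', p x ≤ p x' → U y ((), x) ≠ 0 → U y' ((), x') ≠ 0 → q y ≤ q y' := by
    intro x x' y y' hx hy hy'
    by_contra hq
    have h1 := (φ ⟨_, single_mem_alg hx⟩).2 y y' hq
    rw [← hΦ, hent] at h1
    exact mul_ne_zero hy (star_ne_zero.mpr hy') h1
  have hex : ∀ x, ∃ y, U y ((), x) ≠ 0 := by
    intro x
    by_contra hcon
    push Not at hcon
    have h1 := congrFun (congrFun hU ((), x)) ((), x)
    rw [Matrix.mul_apply] at h1
    simp [hcon] at h1
  choose g hg using hex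
  choose s hs using hp
  refine ⟨⟨fun u => q (g (s u)), fun u v huv => ?_⟩, U, ⟨hU, ?_⟩, fun a => ?_⟩
  · exact hle (s u) (s v) _ _ (by rwa [hs, hs]) (hg _) (hg _)
  · intro y _ x hy
    exact le_antisymm (hle _ _ _ _ (hs _).ge hy (hg _)) (hle _ _ _ _ (hs _).le (hg _) hy)
  · rw [← hΦ, hΦU]

theorem eq_zero_of_conj_mul_conj {ρ σ : Type} [Fintype ρ] [DecidableEq ρ] [Fintype σ]
    [DecidableEq σ] {U : Matrix κ ρ ℂ} {U' : Matrix κ σ ℂ} (hU : Uᴴ * U = 1) (hU' : U'ᴴ * U' = 1)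
    (h : U * Uᴴ * (U' * U'ᴴ) = 0) : Uᴴ * U' = 0 := by
  calc Uᴴ * U' = (Uᴴ * U) * Uᴴ * U' * (U'ᴴ * U') := by
        rw [hU, hU', Matrix.one_mul, Matrix.mul_one]
    _ = Uᴴ * (U * Uᴴ * (U' * U'ᴴ)) * U' := by simp only [Matrix.mul_assoc]
    _ = 0 := by rw [h]; simp

/-- The isometries of the summands are put side by side; orthogonality of the summands at the unit
says that their range projections are orthogonal. -/
theorem IsRegular.exists_hasType [Nonempty H] {p : ι → H} {q : κ → H}
    (hp : Function.Surjective p) {φ : alg p →ₙₐ[ℂ] alg q} (h : IsRegular φ) :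
    ∃ m, HasType φ m := by
  obtain ⟨-, r, θ, hθ, horth, hsum⟩ := h
  choose f U hU hθU using fun i => (hθ i).exists_gradedIsometry hp
  let W : Matrix κ (Fin r × ι) ℂ := Matrix.of fun y c => U c.1 y ((), c.2)
  have hone : ∀ i, (θ i 1).1 = U i * (U i)ᴴ := by
    intro i
    rw [hθU]
    change U i * ((1 : Matrix Unit Unit ℂ) ⊗ₖ (1 : Matrix ι ι ℂ)) * (U i)ᴴ = _
    rw [Matrix.one_kronecker_one, Matrix.mul_one]
  refine ⟨∑ i, MonoidAlgebra.of ℤ (H →o H) (f i), Fin r, inferInstance, inferInstance, f, W,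
    ⟨?_, ?_⟩, ?_, rfl⟩
  · ext ⟨i, x⟩ ⟨j, x'⟩
    change ((U i)ᴴ * U j) ((), x) ((), x') = _
    by_cases hij : i = j
    · subst hij
      rw [(hU i).isometry]
      simp [Matrix.one_apply]
    · rw [eq_zero_of_conj_mul_conj (hU i).isometry (hU j).isometry]
      · simp [Matrix.one_apply, hij]
      · rw [← hone, ← hone]
        exact congrArg Subtype.val (horth i j hij 1 1)
  · intro y i x hy
    exact (hU i).graded y () x hy
  · intro a
    rw [hsum, AddSubmonoidClass.coe_finsetSum, conj_eq_sum_component]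
    exact Finset.sum_congr rfl fun i _ => hθU i a

end RegularForm

/-! ### Uniqueness of types -/

section Uniqueness

variable {H : Type} [PartialOrder H]
variable {ι κ : Type} [Fintype ι] [DecidableEq ι] [Fintype κ] [DecidableEq κ]

theorem eq_of_connected (hH : (SimpleGraph.fromRel (fun u v : H => u ≤ v)).Connected) {α : Type}
    (c : H → α) (hc : ∀ u v, u ≤ v → c u = c v) (u v : H) : c u = c v := by
  obtain ⟨w⟩ := hH.preconnected u v
  induction w with
  | nil => rfl
  | cons h _ ih =>
    refine Eq.trans ?_ ih
    rw [SimpleGraph.fromRel_adj] at h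
    rcases h.2 with h | h
    · exact hc _ _ h
    · exact (hc _ _ h).symm

theorem coeff_sum_of {R M : Type} [Fintype R] [DecidableEq M] [Monoid M] (f : R → M) (g : M) :
    (∑ i, MonoidAlgebra.of ℤ M (f i)).coeff g = (Fintype.card {i // f i = g} : ℤ) := by
  have h : ∀ i, (MonoidAlgebra.of ℤ M (f i)).coeff g = if f i = g then (1 : ℤ) else 0 := by
    intro i
    simp [MonoidAlgebra.of_apply, Finsupp.single_apply]
  rw [MonoidAlgebra.coeff_sum, Finsupp.finsetSum_apply, Finset.sum_congr rfl fun i _ => h i,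
    Fintype.card_subtype, Finset.sum_boole]

/-- The fibres of `f` and `f'` have the same size if a unitary matrix has nonzero entries only
over the diagonal. -/
theorem card_fiber_eq_of_unitary {R R' M : Type} [Fintype R] [DecidableEq R] [Fintype R']
    [DecidableEq R'] [DecidableEq M] {f : R → M} {f' : R' → M} {c : Matrix R' R ℂ}
    (h1 : cᴴ * c = 1) (h2 : c * cᴴ = 1) (hc : ∀ i j, c i j ≠ 0 → f' i = f j) (g : M) :
    Fintype.card {i // f i = g} = Fintype.card {i // f' i = g} := by
  have e1 : ∀ j, ∑ i, star (c i j) * c i j = 1 := fun j => by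
    have := congrFun (congrFun h1 j) j
    simpa [Matrix.mul_apply] using this
  have e2 : ∀ i, ∑ j, star (c i j) * c i j = 1 := fun i => by
    have := congrFun (congrFun h2 i) i
    simpa [Matrix.mul_apply, mul_comm] using this
  -- The sum of `|c i j|²` over the entries lying over `g` is computed by columns and by rows.
  have key : ((Fintype.card {i // f i = g} : ℕ) : ℂ) = (Fintype.card {i // f' i = g} : ℕ) := by
    rw [Fintype.card_subtype, Fintype.card_subtype, Finset.card_eq_sum_ones,
      Finset.card_eq_sum_ones, Finset.sum_filter, Finset.sum_filter]
    push_cast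
    calc ∑ j, (if f j = g then (1 : ℂ) else 0)
        = ∑ j, ∑ i, if f j = g then star (c i j) * c i j else 0 := by
          refine Finset.sum_congr rfl fun j _ => ?_
          split_ifs
          · exact (e1 j).symm
          · simp
      _ = ∑ i, ∑ j, if f' i = g then star (c i j) * c i j else 0 := by
          rw [Finset.sum_comm]
          refine Finset.sum_congr rfl fun i _ => Finset.sum_congr rfl fun j _ => ?_
          by_cases h0 : c i j = 0
          · simp [h0]
          · rw [hc i j h0]
      _ = ∑ i, (if f' i = g then (1 : ℂ) else 0) := by
          refine Finset.sum_congr rfl fun i _ => ?_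
          split_ifs
          · exact e2 i
          · simp
  exact_mod_cast key

/-- The commutant of the amplifications of a connected digraph algebra and its adjoint. -/
theorem exists_eq_kronecker_one
    (hH : (SimpleGraph.fromRel (fun u v : H => u ≤ v)).Connected) {p : ι → H}
    (hp : Function.Surjective p) {R R' : Type} [Fintype R] [DecidableEq R] [Fintype R']
    [DecidableEq R'] {C : Matrix (R' × ι) (R × ι) ℂ}
    (hC : ∀ a ∈ alg p, C * ((1 : Matrix R R ℂ) ⊗ₖ a) = ((1 : Matrix R' R' ℂ) ⊗ₖ a) * C) :
    ∃ c : Matrix R' R ℂ, C = c ⊗ₖ (1 : Matrix ι ι ℂ) := by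
  -- Commutation with the matrix unit `e_{xx'}`, entry by entry.
  have hent : ∀ x x', p x ≤ p x' → ∀ i j y y',
      (if x' = y' then C (i, y) (j, x) else 0) = if y = x then C (i, x') (j, y') else 0 := by
    intro x x' hx i j y y'
    have h := congrFun (congrFun (hC _ (single_mem_alg hx)) (i, y)) (j, y')
    simpa [Matrix.mul_apply, Fintype.sum_prod_type, Matrix.single_apply, Matrix.one_apply,
      ite_and, eq_comm] using h
  have hdiag : ∀ x x', p x ≤ p x' → ∀ i j, C (i, x) (j, x) = C (i, x') (j, x') := by
    intro x x' hx i j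
    simpa using hent x x' hx i j x x'
  have hoff : ∀ x x' i j, x ≠ x' → C (i, x) (j, x') = 0 := by
    intro x x' i j hne
    simpa [hne] using hent x' x' le_rfl i j x x'
  choose s hs using hp
  -- Within a block all indices are comparable; connectedness of `H` passes between representatives
  -- of different blocks.
  have hall : ∀ x x' i j, C (i, x) (j, x) = C (i, x') (j, x') := by
    intro x x' i j
    have h := eq_of_connected hH (fun u => C (i, s u) (j, s u))
      (fun u v huv => hdiag _ _ (by rwa [hs, hs]) i j) (p x) (p x')
    rw [hdiag x (s (p x)) (hs _).ge, hdiag x' (s (p x')) (hs _).ge]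
    exact h
  obtain ⟨u₀⟩ := hH.nonempty
  refine ⟨Matrix.of fun i j => C (i, s u₀) (j, s u₀), ?_⟩
  ext ⟨i, x⟩ ⟨j, x'⟩
  rw [Matrix.kronecker_apply, Matrix.one_apply]
  split_ifs with h
  · subst h
    simpa using hall _ _ _ _
  · simpa using hoff _ _ _ _ h

theorem kronecker_one_injective [Nonempty ι] {R R' : Type} {c d : Matrix R' R ℂ}
    (h : c ⊗ₖ (1 : Matrix ι ι ℂ) = d ⊗ₖ (1 : Matrix ι ι ℂ)) : c = d := by
  obtain ⟨x⟩ := ‹Nonempty ι›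
  ext i j
  simpa using congrFun (congrFun h (i, x)) (j, x)

/-- The matrix `W'ᴴ W` intertwines the two amplifications and is unitary, since the values at `1`
give equal range projections. So it is `c ⊗ 1` with `c` unitary. If `c i j ≠ 0`, then for each `x`
the columns `(i, x)` of `W'` and `(j, x)` of `W` share a row, and the gradings give `f' i = f j`. -/
theorem GradedIsometry.card_fiber_eq
    (hH : (SimpleGraph.fromRel (fun u v : H => u ≤ v)).Connected) {p : ι → H} {q : κ → H}
    (hp : Function.Surjective p) {R R' : Type} [Fintype R] [DecidableEq R] [Fintype R']
    [DecidableEq R'] [DecidableEq (H →o H)] {f : R → H →o H} {f' : R' → H →o H}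
    {W : Matrix κ (R × ι) ℂ}
    {W' : Matrix κ (R' × ι) ℂ} (hW : GradedIsometry p q f W) (hW' : GradedIsometry p q f' W')
    (h : ∀ a ∈ alg p,
      W * ((1 : Matrix R R ℂ) ⊗ₖ a) * Wᴴ = W' * ((1 : Matrix R' R' ℂ) ⊗ₖ a) * W'ᴴ) (g : H →o H) :
    Fintype.card {i // f i = g} = Fintype.card {i // f' i = g} := by
  obtain ⟨u₀⟩ := hH.nonempty
  have : Nonempty ι := (hp u₀).nonempty
  have h1 : W * Wᴴ = W' * W'ᴴ := by
    have := h 1 (one_mem _)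
    simpa [Matrix.one_kronecker_one] using this
  obtain ⟨c, hc⟩ := exists_eq_kronecker_one hH hp (C := W'ᴴ * W) (by
    intro a ha
    calc W'ᴴ * W * ((1 : Matrix R R ℂ) ⊗ₖ a)
        = W'ᴴ * (W * ((1 : Matrix R R ℂ) ⊗ₖ a) * Wᴴ) * W := by
          rw [Matrix.mul_assoc, Matrix.mul_assoc _ _ W, Matrix.mul_assoc _ Wᴴ, hW.isometry,
            Matrix.mul_one]
      _ = (W'ᴴ * W') * ((1 : Matrix R' R' ℂ) ⊗ₖ a) * (W'ᴴ * W) := by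
          rw [h a ha]; simp only [Matrix.mul_assoc]
      _ = _ := by rw [hW'.isometry, Matrix.one_mul])
  have hCs : (W'ᴴ * W)ᴴ = cᴴ ⊗ₖ (1 : Matrix ι ι ℂ) := by
    rw [hc, Matrix.conjTranspose_kronecker, Matrix.conjTranspose_one]
  have hC1 : (W'ᴴ * W)ᴴ * (W'ᴴ * W) = 1 := by
    rw [Matrix.conjTranspose_mul, Matrix.conjTranspose_conjTranspose, Matrix.mul_assoc,
      ← Matrix.mul_assoc W', ← h1, Matrix.mul_assoc, hW.isometry, Matrix.mul_one, hW.isometry]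
  have hC2 : (W'ᴴ * W) * (W'ᴴ * W)ᴴ = 1 := by
    rw [Matrix.conjTranspose_mul, Matrix.conjTranspose_conjTranspose, Matrix.mul_assoc,
      ← Matrix.mul_assoc W, h1, Matrix.mul_assoc, hW'.isometry, Matrix.mul_one, hW'.isometry]
  rw [hCs, hc, ← Matrix.mul_kronecker_mul, Matrix.mul_one, ← Matrix.one_kronecker_one] at hC1 hC2
  refine card_fiber_eq_of_unitary (kronecker_one_injective hC1) (kronecker_one_injective hC2) ?_ g
  intro i j hij
  ext u
  obtain ⟨x, rfl⟩ := hp u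
  have hne : (W'ᴴ * W) (i, x) (j, x) ≠ 0 := by
    rw [hc]
    simpa using hij
  rw [Matrix.mul_apply] at hne
  obtain ⟨y, -, hy⟩ := Finset.exists_ne_zero_of_sum_ne_zero hne
  rw [← hW.graded y j x (right_ne_zero_of_mul hy), ← hW'.graded y i x
    (star_ne_zero.mp (left_ne_zero_of_mul hy))]

theorem HasType.unique (hH : (SimpleGraph.fromRel (fun u v : H => u ≤ v)).Connected) {p : ι → H}
    {q : κ → H} (hp : Function.Surjective p) {φ : alg p →ₙₐ[ℂ] alg q}
    {m m' : MonoidAlgebra ℤ (H →o H)} (h : HasType φ m) (h' : HasType φ m') : m = m' := by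
  classical
  obtain ⟨R, _, _, f, W, hW, hφ, rfl⟩ := h
  obtain ⟨R', _, _, f', W', hW', hφ', rfl⟩ := h'
  ext g
  rw [coeff_sum_of, coeff_sum_of, hW.card_fiber_eq hH hp hW'
    (fun a ha => (hφ ⟨a, ha⟩).symm.trans (hφ' ⟨a, ha⟩)) g]

end Uniqueness

/-! ### Maps of the same type are unitarily equivalent -/

section UnitaryEquivalence

variable {H : Type} [PartialOrder H]
variable {ι κ ρ : Type} [Fintype ι] [DecidableEq ι] [Fintype κ] [DecidableEq κ]
  [Fintype ρ] [DecidableEq ρ]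

/-- The columns of a graded isometry in the block of `h`, as vectors of that block. -/
def blockColumn (q : κ → H) (g : ρ → H) (W : Matrix κ ρ ℂ) (h : H) (c : {c // g c = h}) :
    EuclideanSpace ℂ {y // q y = h} := WithLp.toLp 2 fun y => W y.1 c.1

theorem sum_eq_sum_block (q : κ → H) (h : H) (F : κ → ℂ) (hF : ∀ y, F y ≠ 0 → q y = h)
    [Fintype {y // q y = h}] :
    ∑ y, F y = ∑ y : {y // q y = h}, F y.1 := by
  classical
  rw [← Finset.sum_filter_of_ne (p := fun y => q y = h) fun y _ hy => hF y hy]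
  exact Finset.sum_subtype _ (by simp) F

theorem orthonormal_blockColumn {q : κ → H} {g : ρ → H} {W : Matrix κ ρ ℂ} (hW : Wᴴ * W = 1)
    (hg : ∀ y c, W y c ≠ 0 → q y = g c) (h : H) [Fintype {y // q y = h}] :
    Orthonormal ℂ (blockColumn q g W h) := by
  classical
  rw [orthonormal_iff_ite]
  rintro ⟨c, hc⟩ ⟨c', hc'⟩
  have h1 := congrFun (congrFun hW c) c'
  rw [Matrix.mul_apply, sum_eq_sum_block q h] at h1
  · rw [PiLp.inner_apply]
    simp only [Matrix.conjTranspose_apply] at h1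
    simp only [blockColumn, RCLike.inner_apply, Subtype.mk.injEq]
    rw [Matrix.one_apply] at h1
    rw [← h1]
    refine Finset.sum_congr rfl fun y _ => ?_
    rw [mul_comm]
    rfl
  · intro y hy
    rw [hg y c' (right_ne_zero_of_mul hy), hc']

/-- A graded isometry is part of a block diagonal unitary, and its columns can be put at any
places allowed by the grading. -/
theorem exists_unitary_extension {q : κ → H} {g : ρ → H} {W : Matrix κ ρ ℂ} (hW : Wᴴ * W = 1)
    (hg : ∀ y c, W y c ≠ 0 → q y = g c) {j : ρ → κ} (hj : Function.Injective j)
    (hjg : ∀ c, q (j c) = g c) :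
    ∃ U : Matrix κ κ ℂ, Uᴴ * U = 1 ∧ (∀ y y', U y y' ≠ 0 → q y = q y') ∧
      ∀ y c, U y (j c) = W y c := by
  classical
  have hb : ∀ h : H, ∃ b : OrthonormalBasis {y // q y = h} ℂ (EuclideanSpace ℂ {y // q y = h}),
      ∀ (c : {c // g c = h}) (hc : q (j c.1) = h), b ⟨j c.1, hc⟩ = blockColumn q g W h c := by
    intro h
    let e : {c // g c = h} → {y // q y = h} := fun c => ⟨j c.1, (hjg c.1).trans c.2⟩
    have he : Function.Injective e := fun c c' hcc => Subtype.ext (hj (congrArg Subtype.val hcc))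
    -- The value `0` off the range of `e` plays no role: only the restriction to the range is
    -- extended to a basis.
    have horth : Orthonormal ℂ ((Set.range e).domRestrict
        (Function.extend e (blockColumn q g W h) 0)) := by
      have h1 := (orthonormal_blockColumn hW hg h).comp (Equiv.ofInjective e he).symm
        (Equiv.injective _)
      convert h1 using 1
      ext1 ⟨_, c, rfl⟩
      simp only [Set.domRestrict_apply, Function.comp_apply]
      rw [he.extend_apply]
      congr 1
      rw [Equiv.eq_symm_apply]
      rfl
    obtain ⟨b, hb⟩ := horth.exists_orthonormalBasis_extension_of_card_eq
      (by rw [finrank_euclideanSpace])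
    refine ⟨b, fun c hc => ?_⟩
    rw [hb _ ⟨c, rfl⟩]
    exact he.extend_apply _ _ _
  choose b hb using hb
  -- Column `y'` is the basis vector number `y'` of the block of `y'`, extended by zero to the other
  -- blocks.
  let U : Matrix κ κ ℂ := Matrix.of fun y y' =>
    if h : q y = q y' then b (q y') ⟨y', rfl⟩ ⟨y, h⟩ else 0
  have hU : ∀ (h : H) (y y' : κ) (hy : q y = h) (hy' : q y' = h),
      U y y' = b h ⟨y', hy'⟩ ⟨y, hy⟩ := by
    rintro _ y y' hy rfl
    simp [U, hy]
  have hU0 : ∀ y y', U y y' ≠ 0 → q y = q y' := by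
    intro y y' hne
    by_contra h
    exact hne (by simp [U, h])
  refine ⟨U, ?_, hU0, ?_⟩
  · ext y y'
    rw [Matrix.mul_apply, Matrix.one_apply]
    by_cases hq : q y = q y'
    · rw [sum_eq_sum_block q (q y')]
      · have h1 := (orthonormal_iff_ite.mp (b (q y')).orthonormal) ⟨y, hq⟩ ⟨y', rfl⟩
        simp only [Subtype.mk.injEq] at h1
        rw [← h1, PiLp.inner_apply]
        refine Finset.sum_congr rfl fun z _ => ?_
        rw [Matrix.conjTranspose_apply, hU _ z.1 y z.2 hq, hU _ z.1 y' z.2 rfl, RCLike.inner_apply,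
          mul_comm]
        rfl
      · intro z hz
        exact hU0 _ _ (right_ne_zero_of_mul hz)
    · rw [if_neg (fun h => hq (by rw [h]))]
      refine Finset.sum_eq_zero fun z _ => ?_
      by_contra hz
      exact hq ((hU0 _ _ (star_ne_zero.mp (left_ne_zero_of_mul hz))).symm.trans
        (hU0 _ _ (right_ne_zero_of_mul hz)))
  · intro y c
    by_cases h : q y = g c
    · rw [hU (g c) _ _ h (hjg c), hb (g c) ⟨c, rfl⟩ (hjg c)]
      rfl
    · rw [not_imp_comm.mp (hg y c) h]
      by_contra hne
      exact h ((hU0 _ _ hne).trans (hjg c))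

/-- A dimension count in each block: orthonormal columns are no more numerous than the indices of
the block. -/
theorem exists_injective_of_graded {q : κ → H} {g : ρ → H} {W : Matrix κ ρ ℂ} (hW : Wᴴ * W = 1)
    (hg : ∀ y c, W y c ≠ 0 → q y = g c) :
    ∃ j : ρ → κ, Function.Injective j ∧ ∀ c, q (j c) = g c := by
  classical
  have he : ∀ h : H, Nonempty ({c // g c = h} ↪ {y // q y = h}) := by
    intro h
    refine Function.Embedding.nonempty_of_card_le ?_
    have h1 := (orthonormal_blockColumn hW hg h).linearIndependent.fintype_card_le_finrank
    rwa [finrank_euclideanSpace] at h1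
  have e := fun h => (he h).some
  refine ⟨fun c => (e (g c) ⟨c, rfl⟩).1, ?_, fun c => (e (g c) ⟨c, rfl⟩).2⟩
  intro c c' hcc
  have hgg : g c = g c' := by
    rw [← (e (g c) ⟨c, rfl⟩).2, ← (e (g c') ⟨c', rfl⟩).2]
    exact congrArg q hcc
  have h1 : ∀ (h : H) (hc : g c = h), (e (g c) ⟨c, rfl⟩).1 = (e h ⟨c, hc⟩).1 := by
    rintro _ rfl
    rfl
  have h2 : (e (g c') ⟨c, hgg⟩) = (e (g c') ⟨c', rfl⟩) := by
    apply Subtype.ext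
    rw [← h1]
    exact hcc
  exact congrArg Subtype.val ((e (g c')).injective h2)

/-- Two isometries with the same grading differ by a block diagonal unitary. -/
theorem exists_unitary_mul_eq {q : κ → H} {g : ρ → H} {V W : Matrix κ ρ ℂ} (hW : Wᴴ * W = 1)
    (hg : ∀ y c, W y c ≠ 0 → q y = g c) (hV : Vᴴ * V = 1) (hg' : ∀ y c, V y c ≠ 0 → q y = g c) :
    ∃ u : Matrix κ κ ℂ, u ∈ Matrix.unitaryGroup κ ℂ ∧ u ∈ alg q ∧ u * W = V := by
  obtain ⟨j, hj, hjg⟩ := exists_injective_of_graded hW hg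
  obtain ⟨A, hA, hA0, hAW⟩ := exists_unitary_extension hW hg hj hjg
  obtain ⟨B, hB, hB0, hBV⟩ := exists_unitary_extension hV hg' hj hjg
  have hA' : A * Aᴴ = 1 := mul_eq_one_comm.mp hA
  -- `A` and `B` carry the standard basis vector at the same place `j c` to column `c` of `W` and of
  -- `V`.
  refine ⟨B * Aᴴ, ?_, ?_, ?_⟩
  · rw [Matrix.mem_unitaryGroup_iff', Matrix.star_eq_conjTranspose, Matrix.conjTranspose_mul,
      Matrix.conjTranspose_conjTranspose, Matrix.mul_assoc, ← Matrix.mul_assoc Bᴴ, hB,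
      Matrix.one_mul, hA']
  · refine mul_mem (fun y y' h => ?_) (fun y y' h => ?_)
    · by_contra hne
      exact h (hB0 _ _ hne).le
    · by_contra hne
      exact h (hA0 _ _ (star_ne_zero.mp hne)).ge
  · have h1 : W = A * (1 : Matrix κ κ ℂ).submatrix id j := by
      ext y c
      rw [← hAW, Matrix.mul_apply]
      simp [Matrix.one_apply]
    have h2 : V = B * (1 : Matrix κ κ ℂ).submatrix id j := by
      ext y c
      rw [← hBV, Matrix.mul_apply]
      simp [Matrix.one_apply]
    rw [h1, h2, Matrix.mul_assoc, ← Matrix.mul_assoc Aᴴ, hA, Matrix.one_mul]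

theorem exists_equiv_of_card_fiber_eq {R R' M : Type} [Fintype R] [Fintype R'] [DecidableEq M]
    {f : R → M} {f' : R' → M}
    (h : ∀ g, Fintype.card {i // f i = g} = Fintype.card {i // f' i = g}) :
    ∃ e : R ≃ R', ∀ i, f' (e i) = f i := by
  have E := fun g => (Fintype.card_eq.mp (h g)).some
  refine ⟨(Equiv.sigmaFiberEquiv f).symm.trans
    ((Equiv.sigmaCongrRight E).trans (Equiv.sigmaFiberEquiv f')), fun i => ?_⟩
  exact (E (f i) ⟨i, rfl⟩).2

theorem conj_reindex {R R' : Type} [Fintype R] [DecidableEq R] [Fintype R'] [DecidableEq R']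
    (W : Matrix κ (R' × ι) ℂ) (e : R ≃ R') (a : Matrix ι ι ℂ) :
    W.submatrix id (e.prodCongr (Equiv.refl ι)) * ((1 : Matrix R R ℂ) ⊗ₖ a) *
      (W.submatrix id (e.prodCongr (Equiv.refl ι)))ᴴ = W * ((1 : Matrix R' R' ℂ) ⊗ₖ a) * Wᴴ := by
  have h : (1 : Matrix R R ℂ) ⊗ₖ a = ((1 : Matrix R' R' ℂ) ⊗ₖ a).submatrix
      (e.prodCongr (Equiv.refl ι)) (e.prodCongr (Equiv.refl ι)) := by
    ext ⟨i, x⟩ ⟨j, x'⟩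
    simp [Matrix.one_apply]
  rw [h, Matrix.conjTranspose_submatrix, Matrix.submatrix_mul_equiv, Matrix.submatrix_mul_equiv,
    Matrix.submatrix_id_id]

/-- Equal types mean equal multiplicities of each endomorphism, so the summands can be matched by a
bijection. After reindexing, both isometries have the same grading. -/
theorem HasType.exists_unitary {p : ι → H} {q : κ → H} {φ ψ : alg p →ₙₐ[ℂ] alg q}
    {m : MonoidAlgebra ℤ (H →o H)} (hφ : HasType φ m) (hψ : HasType ψ m) :
    ∃ u : Matrix κ κ ℂ, u ∈ Matrix.unitaryGroup κ ℂ ∧ u ∈ alg q ∧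
      ∀ a, u * (φ a).1 * uᴴ = (ψ a).1 := by
  classical
  obtain ⟨R, _, _, f, W, hW, hφ, rfl⟩ := hφ
  obtain ⟨R', _, _, f', W', hW', hψ, hm⟩ := hψ
  obtain ⟨e, he⟩ := exists_equiv_of_card_fiber_eq (f := f) (f' := f') (by
    intro g
    have := congrArg (fun m => m.coeff g) hm
    simp only [coeff_sum_of] at this
    exact_mod_cast this)
  have hV : (W'.submatrix id (e.prodCongr (Equiv.refl ι)))ᴴ *
      W'.submatrix id (e.prodCongr (Equiv.refl ι)) = 1 := by
    rw [Matrix.conjTranspose_submatrix, ← Matrix.submatrix_mul _ _ _ _ _ Function.bijective_id,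
      hW'.isometry, Matrix.submatrix_one_equiv]
  obtain ⟨u, hu, huq, huW⟩ := exists_unitary_mul_eq (q := q) (g := fun c : R × ι => f c.1 (p c.2))
    hW.isometry (fun y c => hW.graded y c.1 c.2) hV
    (fun y c hy => (hW'.graded y (e c.1) c.2 hy).trans (by rw [he]))
  refine ⟨u, hu, huq, fun a => ?_⟩
  rw [hφ, hψ, ← conj_reindex W' e, ← huW, Matrix.conjTranspose_mul]
  simp only [Matrix.mul_assoc]

/-- Unitaries of a digraph algebra are block diagonal. -/
theorem graded_of_unitary {q : κ → H} {u : Matrix κ κ ℂ} (hu : u ∈ Matrix.unitaryGroup κ ℂ)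
    (hq : u ∈ alg q) (y y' : κ) (hy : u y y' ≠ 0) : q y = q y' := by
  -- In finite dimension injective left multiplication by `u` is surjective, so the inverse `uᴴ`
  -- also lies in the algebra. Antisymmetry then excludes entries between different blocks.
  have hinj : Function.Injective (LinearMap.mulLeft ℂ (⟨u, hq⟩ : alg q)) := by
    intro a b hab
    apply Subtype.ext
    have h1 : u * a.1 = u * b.1 := congrArg Subtype.val hab
    have h2 := congrArg (fun z => star u * z) h1
    simpa [← Matrix.mul_assoc, Matrix.mem_unitaryGroup_iff'.mp hu] using h2
  obtain ⟨v, hv⟩ := (LinearMap.injective_iff_surjective.mp hinj) 1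
  have hv' : u * v.1 = 1 := congrArg Subtype.val hv
  have huv : uᴴ = v.1 := by
    calc uᴴ = star u * (u * v.1) := by rw [hv', Matrix.mul_one, Matrix.star_eq_conjTranspose]
      _ = v.1 := by rw [← Matrix.mul_assoc, Matrix.mem_unitaryGroup_iff'.mp hu, Matrix.one_mul]
  refine le_antisymm ?_ ?_
  · by_contra h
    exact hy (hq y y' h)
  · by_contra h
    have h1 := v.2 y' y h
    rw [← huv, Matrix.conjTranspose_apply] at h1
    exact hy (star_eq_zero.mp h1)

theorem GradedIsometry.unitary_mul {R : Type} [Fintype R] [DecidableEq R] {p : ι → H}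
    {q : κ → H} {f : R → H →o H}
    {W : Matrix κ (R × ι) ℂ} (hW : GradedIsometry p q f W) {u : Matrix κ κ ℂ}
    (hu : u ∈ Matrix.unitaryGroup κ ℂ) (hq : u ∈ alg q) : GradedIsometry p q f (u * W) where
  isometry := by
    rw [Matrix.conjTranspose_mul, Matrix.mul_assoc, ← Matrix.mul_assoc uᴴ,
      ← Matrix.star_eq_conjTranspose u, Matrix.mem_unitaryGroup_iff'.mp hu, Matrix.one_mul,
      hW.isometry]
  graded y i x hne := by
    rw [Matrix.mul_apply] at hne
    obtain ⟨z, -, hz⟩ := Finset.exists_ne_zero_of_sum_ne_zero hne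
    rw [graded_of_unitary hu hq y z (left_ne_zero_of_mul hz),
      hW.graded z i x (right_ne_zero_of_mul hz)]

theorem HasType.exists_conj {p : ι → H} {q : κ → H} {φ : alg p →ₙₐ[ℂ] alg q}
    {m : MonoidAlgebra ℤ (H →o H)} (hφ : HasType φ m) {u : Matrix κ κ ℂ}
    (hu : u ∈ Matrix.unitaryGroup κ ℂ) (hq : u ∈ alg q) :
    ∃ ψ : alg p →ₙₐ[ℂ] alg q, HasType ψ m ∧ ∀ a, u * (φ a).1 * uᴴ = (ψ a).1 := by
  obtain ⟨R, _, _, f, W, hW, hφ, rfl⟩ := hφ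
  refine ⟨(hW.unitary_mul hu hq).hom, (hW.unitary_mul hu hq).hasType_hom, fun a => ?_⟩
  change _ = u * W * _ * (u * W)ᴴ
  rw [hφ, Matrix.conjTranspose_mul]
  simp only [Matrix.mul_assoc]

theorem HasType.conj {p : ι → H} {q : κ → H} {φ ψ : alg p →ₙₐ[ℂ] alg q}
    {m : MonoidAlgebra ℤ (H →o H)} (hφ : HasType φ m) {u : Matrix κ κ ℂ}
    (hu : u ∈ Matrix.unitaryGroup κ ℂ) (hq : u ∈ alg q) (h : ∀ a, u * (φ a).1 * uᴴ = (ψ a).1) :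
    HasType ψ m := by
  obtain ⟨ψ', hψ', hu'⟩ := hφ.exists_conj hu hq
  have h1 : ψ = ψ' := by
    ext1 a
    exact Subtype.ext ((h a).symm.trans (hu' a))
  rwa [h1]

end UnitaryEquivalence

/-! ### Calculus of types -/

section Calculus

variable {H : Type} [PartialOrder H]
variable {ι κ τ R : Type} [Fintype ι] [DecidableEq ι] [Fintype κ] [DecidableEq κ]
  [Fintype τ] [DecidableEq τ] [Fintype R] [DecidableEq R]

theorem conj_submatrix_equiv {ρ σ : Type} [Fintype ρ] [Fintype σ] (X : Matrix κ σ ℂ)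
    (e : ρ ≃ σ) (A : Matrix σ σ ℂ) :
    X.submatrix id e * A.submatrix e e * (X.submatrix id e)ᴴ = X * A * Xᴴ := by
  rw [Matrix.conjTranspose_submatrix, Matrix.submatrix_mul_equiv, Matrix.submatrix_mul_equiv,
    Matrix.submatrix_id_id]

theorem isometry_submatrix_equiv {ρ σ : Type} [Fintype ρ] [Fintype σ] [DecidableEq ρ]
    [DecidableEq σ] {X : Matrix κ σ ℂ} (hX : Xᴴ * X = 1) (e : ρ ≃ σ) :
    (X.submatrix id e)ᴴ * X.submatrix id e = 1 := by
  rw [Matrix.conjTranspose_submatrix, ← Matrix.submatrix_mul _ _ _ _ _ Function.bijective_id,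
    hX, Matrix.submatrix_one_equiv]

/-- The composition is implemented by `W' (1 ⊗ W)`, whose summand `(i, j)` has the grading `f' i ∘ f
j`. -/
theorem HasType.comp {p : ι → H} {q : κ → H} {s : τ → H} {ψ : alg q →ₙₐ[ℂ] alg s}
    {φ : alg p →ₙₐ[ℂ] alg q} {n m : MonoidAlgebra ℤ (H →o H)} (hψ : HasType ψ n)
    (hφ : HasType φ m) : HasType (ψ.comp φ) (n * m) := by
  obtain ⟨R', _, _, f', W', hW', hψ, rfl⟩ := hψ
  obtain ⟨R, _, _, f, W, hW, hφ, rfl⟩ := hφ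
  refine ⟨R' × R, inferInstance, inferInstance, fun i => f' i.1 * f i.2,
    (W' * ((1 : Matrix R' R' ℂ) ⊗ₖ W)).submatrix id (Equiv.prodAssoc R' R ι), ⟨?_, ?_⟩, ?_, ?_⟩
  · refine isometry_submatrix_equiv ?_ _
    rw [Matrix.conjTranspose_mul, Matrix.mul_assoc, ← Matrix.mul_assoc W'ᴴ, hW'.isometry,
      Matrix.one_mul, Matrix.conjTranspose_kronecker, ← Matrix.mul_kronecker_mul, hW.isometry,
      Matrix.conjTranspose_one, Matrix.mul_one, Matrix.one_kronecker_one]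
  · rintro z ⟨i, j⟩ x hne
    change (W' * ((1 : Matrix R' R' ℂ) ⊗ₖ W)) z (i, (j, x)) ≠ 0 at hne
    rw [Matrix.mul_apply] at hne
    obtain ⟨⟨i', y⟩, -, hy⟩ := Finset.exists_ne_zero_of_sum_ne_zero hne
    have h1 := left_ne_zero_of_mul hy
    have h2 := right_ne_zero_of_mul hy
    rw [Matrix.kronecker_apply, Matrix.one_apply] at h2
    have h3 : i' = i := by
      by_contra h
      simp [h] at h2
    subst h3
    rw [hW'.graded _ _ _ h1, hW.graded _ _ _ (right_ne_zero_of_mul h2)]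
    rfl
  · intro a
    have h1 : (1 : Matrix (R' × R) (R' × R) ℂ) ⊗ₖ a.1 =
        ((1 : Matrix R' R' ℂ) ⊗ₖ ((1 : Matrix R R ℂ) ⊗ₖ a.1)).submatrix (Equiv.prodAssoc R' R ι)
          (Equiv.prodAssoc R' R ι) := by
      ext ⟨⟨i, j⟩, x⟩ ⟨⟨i', j'⟩, x'⟩
      simp only [Matrix.submatrix_apply, Equiv.prodAssoc_apply, Matrix.kronecker_apply,
        Matrix.one_apply, Prod.mk.injEq, ite_and]
      split_ifs <;> simp
    rw [h1, conj_submatrix_equiv, NonUnitalAlgHom.comp_apply, hψ, hφ, Matrix.conjTranspose_mul,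
      Matrix.conjTranspose_kronecker, Matrix.conjTranspose_one]
    have h2 : (1 : Matrix R' R' ℂ) ⊗ₖ (W * ((1 : Matrix R R ℂ) ⊗ₖ a.1) * Wᴴ) =
        ((1 : Matrix R' R' ℂ) ⊗ₖ W) * ((1 : Matrix R' R' ℂ) ⊗ₖ ((1 : Matrix R R ℂ) ⊗ₖ a.1)) *
          ((1 : Matrix R' R' ℂ) ⊗ₖ Wᴴ) := by
      rw [← Matrix.mul_kronecker_mul, ← Matrix.mul_kronecker_mul, Matrix.mul_one, Matrix.mul_one]
    rw [h2]
    simp only [Matrix.mul_assoc]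
  · rw [Finset.sum_mul_sum, Fintype.sum_prod_type]
    simp only [map_mul]

/-- The matrix with a one in the column `c` at the place `j c`. -/
def placement {ρ : Type} (j : ρ → κ) : Matrix κ ρ ℂ := (1 : Matrix κ κ ℂ).submatrix id j

theorem placement_apply {ρ : Type} (j : ρ → κ) (y : κ) (c : ρ) :
    placement j y c = if y = j c then 1 else 0 := Matrix.one_apply

theorem placement_isometry {ρ : Type} [DecidableEq ρ] {j : ρ → κ} (hj : Function.Injective j) :
    (placement j)ᴴ * placement j = 1 := by
  rw [placement, Matrix.conjTranspose_submatrix, Matrix.conjTranspose_one,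
    ← Matrix.submatrix_mul _ _ _ _ _ Function.bijective_id, Matrix.mul_one,
    Matrix.submatrix_one _ hj]

theorem placement_conj_apply {ρ : Type} [Fintype ρ] (j : ρ → κ) (A : Matrix ρ ρ ℂ) (y y' : κ) :
    (placement j * A * (placement j)ᴴ) y y' =
      ∑ c, ∑ c', if y = j c ∧ y' = j c' then A c c' else 0 := by
  simp only [Matrix.mul_apply, Matrix.conjTranspose_apply, placement_apply, Finset.sum_mul]
  rw [Finset.sum_comm]
  refine Finset.sum_congr rfl fun c _ => Finset.sum_congr rfl fun c' _ => ?_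
  by_cases h1 : y = j c <;> by_cases h2 : y' = j c' <;> simp [h1, h2]

theorem placement_conj_eq_sum {ρ : Type} [Fintype ρ] (j : ρ → κ) (A : Matrix ρ ρ ℂ) :
    placement j * A * (placement j)ᴴ = ∑ c, ∑ c', Matrix.single (j c) (j c') (A c c') := by
  ext y y'
  rw [placement_conj_apply]
  simp only [Matrix.sum_apply, Matrix.single_apply]
  refine Finset.sum_congr rfl fun c _ => Finset.sum_congr rfl fun c' _ => ?_
  simp only [eq_comm]

theorem placement_gradedIsometry {p : ι → H} {q : κ → H} {f : R → H →o H} {j : R × ι → κ}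
    (hj : Function.Injective j) (hq : ∀ i x, q (j (i, x)) = f i (p x)) :
    GradedIsometry p q f (placement j) where
  isometry := placement_isometry hj
  graded y i x h := by
    rw [placement_apply] at h
    rw [← hq, not_imp_comm.mp (if_neg (c := y = j (i, x)) (t := (1 : ℂ)) (e := 0)) h]

/-- The type of a multiplicity one map that maps matrix units to matrix units. -/
theorem hasType_of_placement {p : ι → H} {q : κ → H} {f : H →o H} {j : ι → κ}
    (hj : Function.Injective j) (hq : ∀ x, q (j x) = f (p x)) {φ : alg p →ₙₐ[ℂ] alg q}
    (hφ : ∀ a, (φ a).1 = ∑ x, ∑ x', Matrix.single (j x) (j x') (a.1 x x')) :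
    HasType φ (MonoidAlgebra.of ℤ (H →o H) f) := by
  refine ⟨Unit, inferInstance, inferInstance, fun _ => f, placement (fun c => j c.2),
    placement_gradedIsometry ?_ fun _ x => hq x, fun a => ?_, by simp⟩
  · rintro ⟨_, x⟩ ⟨_, x'⟩ h
    exact Prod.ext rfl (hj h)
  · rw [hφ, placement_conj_eq_sum]
    simp [Fintype.sum_prod_type]

theorem hasType_id (p : ι → H) : HasType (NonUnitalAlgHom.id ℂ (alg p)) 1 := by
  refine hasType_of_placement (p := p) (q := p) (f := 1) (j := id) Function.injective_id
    (fun x => rfl) fun a => ?_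
  exact Matrix.matrix_eq_sum_single a.1

theorem hasType_theta [Fintype H] [DecidableEq H] (f : H →o H) :
    HasType (theta f) (MonoidAlgebra.of ℤ (H →o H) f) := by
  refine hasType_of_placement (p := id) (q := amp id (Fintype.card H)) (f := f)
    (j := fun u => (f u, Fintype.equivFin H u)) ?_ (fun u => rfl) ?_
  -- The second coordinate keeps the placement injective even when `f` is not.
  · intro u v h
    exact (Fintype.equivFin H).injective (congrArg Prod.snd h)
  · intro a
    change (∑ u : H, ∑ v : H, (⟨_, _⟩ : alg (amp (id : H → H) (Fintype.card H)))).1 = _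
    rw [AddSubmonoidClass.coe_finsetSum]
    refine Finset.sum_congr rfl fun u _ => ?_
    rw [AddSubmonoidClass.coe_finsetSum]
    refine Finset.sum_congr rfl fun v _ => ?_
    simp [Matrix.single_kronecker_single]

theorem hasType_flatten (p : ι → H) (n K : ℕ) : HasType (flatten p n K) 1 := by
  let e := ((Equiv.refl ι).prodCongr (finProdFinEquiv (m := n) (n := K)).symm).trans
    (Equiv.prodAssoc ι (Fin n) (Fin K)).symm
  refine hasType_of_placement (f := 1) (j := e.symm) e.symm.injective (fun x => ?_) fun a => ?_
  · rfl
  · change a.1.submatrix e e = _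
    conv_lhs => rw [Matrix.matrix_eq_sum_single a.1]
    ext y y'
    simp [Matrix.sum_apply, Matrix.single_apply, Equiv.symm_apply_eq]

/-- The implementing isometry is `W ⊗ J` with `J` the corner inclusion; block labels ignore the
matrix coordinate. -/
theorem HasType.ampMap {p : ι → H} {q : κ → H} {φ : alg p →ₙₐ[ℂ] alg q}
    {m : MonoidAlgebra ℤ (H →o H)} (hφ : HasType φ m) {n N : ℕ} (h : n ≤ N) :
    HasType (ampMap φ h) m := by
  obtain ⟨R, _, _, f, W, hW, hφ, rfl⟩ := hφ
  let e : R × (ι × Fin n) ≃ (R × ι) × Fin n := (Equiv.prodAssoc R ι (Fin n)).symm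
  let J : Matrix (Fin N) (Fin n) ℂ := placement (Fin.castLE h)
  have hJ : Jᴴ * J = 1 := placement_isometry (Fin.castLE_injective h)
  refine ⟨R, inferInstance, inferInstance, f, (W ⊗ₖ J).submatrix id e, ⟨?_, ?_⟩, ?_, rfl⟩
  · refine isometry_submatrix_equiv ?_ _
    rw [Matrix.conjTranspose_kronecker, ← Matrix.mul_kronecker_mul, hW.isometry, hJ,
      Matrix.one_kronecker_one]
  · rintro ⟨y, c⟩ i ⟨x, d⟩ hne
    exact hW.graded y i x (left_ne_zero_of_mul hne)
  · intro a
    have h1 : (1 : Matrix R R ℂ) ⊗ₖ a.1 = (∑ c, ∑ d, ((1 : Matrix R R ℂ) ⊗ₖ (entry a c d).1) ⊗ₖ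
        Matrix.single c d (1 : ℂ)).submatrix e e := by
      ext ⟨i, x, c⟩ ⟨i', x', c'⟩
      simp [e, Matrix.sum_apply, Matrix.single_apply, ite_and, entry]
      rfl
    have h2 : ∀ c d : Fin n, J * Matrix.single c d (1 : ℂ) * Jᴴ =
        Matrix.single (Fin.castLE h c) (Fin.castLE h d) (1 : ℂ) := by
      intro c d
      rw [placement_conj_eq_sum, Finset.sum_eq_single c, Finset.sum_eq_single d]
      · simp
      · intro d' _ hd
        simp [Matrix.single_apply, hd.symm]
      · simp
      · intro c' _ hc
        simp [Matrix.single_apply, hc.symm]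
      · simp
    rw [h1, conj_submatrix_equiv, Matrix.conjTranspose_kronecker]
    simp only [Matrix.mul_sum, Matrix.sum_mul, ← Matrix.mul_kronecker_mul, h2, ← hφ]
    change (∑ c : Fin n, ∑ d : Fin n, (⟨_, _⟩ : alg (amp q N))).1 = _
    simp only [AddSubmonoidClass.coe_finsetSum]

/-- The block diagonal sum of graded isometries. -/
def blockSum {n m : ℕ} {R R' : Type} (W : Matrix (κ × Fin n) (R × ι) ℂ)
    (W' : Matrix (κ × Fin m) (R' × ι) ℂ) : Matrix (κ × Fin (n + m)) ((R ⊕ R') × ι) ℂ :=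
  (Matrix.fromBlocks W 0 0 W').submatrix
    ((Equiv.prodSumDistrib κ (Fin n) (Fin m)).symm.trans
          ((Equiv.refl κ).prodCongr finSumFinEquiv)).symm
    (Equiv.sumProdDistrib R R' ι)

theorem conj_blockSum {n m : ℕ} {R R' : Type} [Fintype R] [DecidableEq R] [Fintype R']
    [DecidableEq R'] (W : Matrix (κ × Fin n) (R × ι) ℂ)
    (W' : Matrix (κ × Fin m) (R' × ι) ℂ) (a : Matrix ι ι ℂ) :
    blockSum W W' * ((1 : Matrix (R ⊕ R') (R ⊕ R') ℂ) ⊗ₖ a) * (blockSum W W')ᴴ =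
      Matrix.reindex
        ((Equiv.prodSumDistrib κ (Fin n) (Fin m)).symm.trans
          ((Equiv.refl κ).prodCongr finSumFinEquiv))
        ((Equiv.prodSumDistrib κ (Fin n) (Fin m)).symm.trans
          ((Equiv.refl κ).prodCongr finSumFinEquiv))
        (Matrix.fromBlocks (W * ((1 : Matrix R R ℂ) ⊗ₖ a) * Wᴴ) 0 0
          (W' * ((1 : Matrix R' R' ℂ) ⊗ₖ a) * W'ᴴ)) := by
  have h1 : (1 : Matrix (R ⊕ R') (R ⊕ R') ℂ) ⊗ₖ a =
      (Matrix.fromBlocks ((1 : Matrix R R ℂ) ⊗ₖ a) 0 0 ((1 : Matrix R' R' ℂ) ⊗ₖ a)).submatrix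
        (Equiv.sumProdDistrib R R' ι) (Equiv.sumProdDistrib R R' ι) := by
    ext ⟨i | i, x⟩ ⟨i' | i', x'⟩ <;> simp [Matrix.one_apply]
  rw [h1, blockSum, Matrix.conjTranspose_submatrix, Matrix.submatrix_mul_equiv,
    Matrix.submatrix_mul_equiv, Matrix.reindex_apply, Matrix.fromBlocks_conjTranspose,
    Matrix.fromBlocks_multiply, Matrix.fromBlocks_multiply]
  simp

theorem GradedIsometry.blockSum {p : ι → H} {q : κ → H} {n m : ℕ} {R R' : Type} [Fintype R]
    [DecidableEq R] [Fintype R'] [DecidableEq R'] {f : R → H →o H} {f' : R' → H →o H}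
    {W : Matrix (κ × Fin n) (R × ι) ℂ} {W' : Matrix (κ × Fin m) (R' × ι) ℂ}
    (hW : GradedIsometry p (amp q n) f W) (hW' : GradedIsometry p (amp q m) f' W') :
    GradedIsometry p (amp q (n + m)) (Sum.elim f f') (blockSum W W') where
  isometry := by
    rw [HSystem.blockSum, Matrix.conjTranspose_submatrix, Matrix.submatrix_mul_equiv,
      Matrix.fromBlocks_conjTranspose, Matrix.fromBlocks_multiply]
    simp [hW.isometry, hW'.isometry, Matrix.fromBlocks_one]
  graded y i x h := by
    obtain ⟨z, rfl⟩ := ((Equiv.prodSumDistrib κ (Fin n) (Fin m)).symm.trans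
          ((Equiv.refl κ).prodCongr finSumFinEquiv)).surjective y
    rw [HSystem.blockSum, Matrix.submatrix_apply, Equiv.symm_apply_apply] at h
    rcases z with ⟨y, c⟩ | ⟨y, c⟩ <;> rcases i with i | i
    · exact hW.graded (y, c) i x h
    · exact absurd rfl h
    · exact absurd rfl h
    · exact hW'.graded (y, c) i x h

theorem HasType.directSum {p : ι → H} {q : κ → H} {n m : ℕ} {φ : alg q →ₙₐ[ℂ] alg (amp p n)}
    {ψ : alg q →ₙₐ[ℂ] alg (amp p m)} {s t : MonoidAlgebra ℤ (H →o H)} (hφ : HasType φ s)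
    (hψ : HasType ψ t) : (∃ χ, IsDirectSum φ ψ χ) ∧ ∀ χ, IsDirectSum φ ψ χ → HasType χ (s + t) := by
  obtain ⟨R, _, _, f, W, hW, hφ, rfl⟩ := hφ
  obtain ⟨R', _, _, f', W', hW', hψ, rfl⟩ := hψ
  refine ⟨⟨(hW.blockSum hW').hom, fun a => ?_⟩, fun χ hχ => ⟨R ⊕ R', inferInstance, inferInstance,
    _, _, hW.blockSum hW', fun a => ?_, ?_⟩⟩
  · rw [hφ, hψ]
    exact conj_blockSum W W' a.1
  · rw [hχ a, hφ, hψ]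
    exact (conj_blockSum W W' a.1).symm
  · simp

/-- Every positive type is realized by maps into large amplifications. -/
theorem exists_hasType_amp {p : ι → H} {q : κ → H} (hq : Function.Surjective q) {R : Type}
    [Fintype R] (f : R → H →o H) :
    ∃ (n : ℕ) (φ : alg p →ₙₐ[ℂ] alg (amp q n)),
      HasType φ (∑ i, MonoidAlgebra.of ℤ (H →o H) (f i)) := by
  classical
  choose s hs using hq
  -- Each column of the isometry gets its own coordinate of `M_n`, so no two places collide.
  have hj : Function.Injective fun c : R × ι => (s (f c.1 (p c.2)), Fintype.equivFin (R × ι) c) :=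
    fun c c' h => (Fintype.equivFin (R × ι)).injective (congrArg Prod.snd h)
  exact ⟨Fintype.card (R × ι), _,
    (placement_gradedIsometry (p := p) (q := amp q _) (f := f) hj fun i x => hs _).hasType_hom⟩

/-- The identity type is realized by a map `A(H) → A ⊗ M_1`. -/
theorem exists_hasType_one [Fintype H] [DecidableEq H] {q : κ → H} (hq : Function.Surjective q) :
    ∃ φ : alg (id : H → H) →ₙₐ[ℂ] alg (amp q 1), HasType φ 1 := by
  choose s hs using hq
  have hj : Function.Injective fun c : Unit × H => (s c.2, (0 : Fin 1)) := by
    rintro ⟨_, u⟩ ⟨_, v⟩ h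
    have h1 : s u = s v := congrArg Prod.fst h
    rw [← hs u, ← hs v, h1]
  have h1 := (placement_gradedIsometry (p := (id : H → H)) (q := amp q 1) (f := fun _ => 1) hj
    fun i x => hs _).hasType_hom
  exact ⟨_, by simpa [MonoidAlgebra.one_def] using h1⟩

/-- The identification `A = A ⊗ M_1` preserves types. -/
theorem exists_hasType_amp_one (q : κ → H) :
    ∃ φ : alg q →ₙₐ[ℂ] alg (amp q 1), HasType φ 1 := by
  have hj : Function.Injective fun c : Unit × κ => (c.2, (0 : Fin 1)) := by
    rintro ⟨_, u⟩ ⟨_, v⟩ h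
    exact Prod.ext rfl (congrArg Prod.fst h)
  have h1 := (placement_gradedIsometry (p := q) (q := amp q 1) (f := fun _ => 1) hj
    fun i x => rfl).hasType_hom
  exact ⟨_, by simpa [MonoidAlgebra.one_def] using h1⟩

/-- `θ_f` is applied first and so acts on the right, whereas the maps of a system act on the left.
The two actions commute, which makes the limit a right module. -/
theorem HasType.compTheta [Fintype H] [DecidableEq H] {p : ι → H} {n : ℕ}
    {φ : alg (id : H → H) →ₙₐ[ℂ] alg (amp p n)} {m : MonoidAlgebra ℤ (H →o H)} (hφ : HasType φ m)
    (f : H →o H) : HasType (compTheta φ f) (m * MonoidAlgebra.of ℤ (H →o H) f) := by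
  have h := (hasType_flatten p n (Fintype.card H)).comp ((hφ.ampMap le_rfl).comp (hasType_theta f))
  rwa [one_mul] at h

end Calculus

/-! ### Direct limits of free right modules of rank one -/

section Limit

variable {A : Type} [Ring A]

/-- The product `a (j - 1) * ⋯ * a k`, for `k ≤ j`. -/
def carry (a : ℕ → A) (k : ℕ) : ℕ → A
  | 0 => 1
  -- For `k = j + 1` the value `1` is the empty product; for larger `k` it is a default.
  | j + 1 => if k ≤ j then a j * carry a k j else 1

theorem carry_self (a : ℕ → A) (k : ℕ) : carry a k k = 1 := by
  cases k with
  | zero => rfl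
  | succ k => simp [carry]

theorem carry_succ (a : ℕ → A) {k j : ℕ} (h : k ≤ j) : carry a k (j + 1) = a j * carry a k j := by
  simp [carry, h]

theorem carry_mul_carry (a : ℕ → A) {k j l : ℕ} (h : k ≤ j) (h' : j ≤ l) :
    carry a j l * carry a k j = carry a k l := by
  induction l, h' using Nat.le_induction with
  | base => rw [carry_self, one_mul]
  | succ l hl ih => rw [carry_succ a hl, carry_succ a (h.trans hl), mul_assoc, ih]

/-- Left multiplication, a homomorphism of right modules. -/
def leftMul (z : A) : A →ₗ[Aᵐᵒᵖ] A where
  toFun x := z * x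
  map_add' x y := mul_add z x y
  map_smul' r x := by simp [MulOpposite.smul_eq_mul_unop, mul_assoc]

/-- The limit of the right modules `A → A → ⋯` under left multiplication by `a 0`, `a 1`, …. -/
abbrev Lim (a : ℕ → A) : Type :=
  Module.DirectLimit (R := Aᵐᵒᵖ) (fun _ : ℕ => A) (fun i j _ => leftMul (carry a i j))

instance (a : ℕ → A) :
    DirectedSystem (fun _ : ℕ => A) (fun i j (_ : i ≤ j) => leftMul (carry a i j)) where
  map_self i x := by
    change carry a i i * x = x
    rw [carry_self, one_mul]
  map_map k j i hij hjk x := by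
    change carry a j k * (carry a i j * x) = carry a i k * x
    rw [← mul_assoc, carry_mul_carry a hij hjk]

/-- The canonical maps into the limit. -/
def Lim.of (a : ℕ → A) (k : ℕ) : A →ₗ[Aᵐᵒᵖ] Lim a :=
  Module.DirectLimit.of Aᵐᵒᵖ ℕ (fun _ => A) (fun i j _ => leftMul (carry a i j)) k

theorem Lim.of_carry (a : ℕ → A) {k j : ℕ} (h : k ≤ j) (x : A) :
    Lim.of a j (carry a k j * x) = Lim.of a k x :=
  Module.DirectLimit.of_f (R := Aᵐᵒᵖ) (G := fun _ : ℕ => A)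
    (f := fun i j _ => leftMul (carry a i j)) (hij := h)

theorem Lim.of_mul (a : ℕ → A) (k : ℕ) (x y : A) :
    Lim.of a k (x * y) = MulOpposite.op y • Lim.of a k x := by
  rw [← map_smul]
  rfl

theorem Lim.exists_of {a : ℕ → A} (z : Lim a) : ∃ k x, Lim.of a k x = z :=
  Module.DirectLimit.exists_of z

/-- The bound `N` allows a stage as late as desired, which later yields strictly increasing indices.
-/
theorem Lim.eventually_eq {a : ℕ → A} {k l : ℕ} {x y : A} (h : Lim.of a k x = Lim.of a l y)
    (N : ℕ) : ∃ j, N ≤ j ∧ k ≤ j ∧ l ≤ j ∧ carry a k j * x = carry a l j * y := by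
  have hk : k ≤ max N (max k l) := (le_max_left _ _).trans (le_max_right _ _)
  have hl : l ≤ max N (max k l) := (le_max_right _ _).trans (le_max_right _ _)
  rw [← Lim.of_carry a hk, ← Lim.of_carry a hl] at h
  obtain ⟨j, hj, hj'⟩ := Module.DirectLimit.exists_eq_of_of_eq h
  refine ⟨j, (le_max_left _ _).trans hj, hk.trans hj, hl.trans hj, ?_⟩
  change carry a _ j * (carry a k _ * x) = carry a _ j * (carry a l _ * y) at hj'
  rwa [← mul_assoc, ← mul_assoc, carry_mul_carry a hk hj, carry_mul_carry a hl hj] at hj'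

/-- The map of limits induced by one half of an intertwining. -/
theorem Lim.exists_map {a a' : ℕ → A} {n m : ℕ → ℕ} (hn : StrictMono n) (hm : StrictMono m)
    {b c : ℕ → A} (hcb : ∀ k, c k * b k = carry a (n k) (n (k + 1)))
    (hbc : ∀ k, b (k + 1) * c k = carry a' (m k) (m (k + 1))) :
    ∃ F : Lim a →ₗ[Aᵐᵒᵖ] Lim a', ∀ k x, F (Lim.of a (n k) x) = Lim.of a' (m k) (b k * x) := by
  have key : ∀ i j, i ≤ j → ∀ x,
      Lim.of a' (m j) (b j * (carry a (n i) (n j) * x)) = Lim.of a' (m i) (b i * x) := by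
    intro i j hij x
    induction j, hij using Nat.le_induction with
    | base => rw [carry_self, one_mul]
    | succ j hj ih =>
      rw [← ih, ← Lim.of_carry a' (hm.monotone (Nat.le_succ j)), ← hbc,
        ← carry_mul_carry a (hn.monotone hj) (hn.monotone (Nat.le_succ j)), ← hcb]
      simp only [mul_assoc]
  have hni : ∀ i, i ≤ n i := fun i => hn.le_apply
  -- The map is needed at every level `i`, so an element is first carried to the intertwining level
  -- `n i ≥ i`.
  let g : ∀ i : ℕ, A →ₗ[Aᵐᵒᵖ] Lim a' := fun i =>
    (Lim.of a' (m i)).comp (leftMul (b i * carry a i (n i)))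
  have hg : ∀ i x, g i x = Lim.of a' (m i) (b i * carry a i (n i) * x) := fun _ _ => rfl
  refine ⟨Module.DirectLimit.lift Aᵐᵒᵖ ℕ (fun _ => A) (fun i j _ => leftMul (carry a i j)) g ?_, ?_⟩
  · intro i j hij x
    change g j (carry a i j * x) = g i x
    rw [hg, hg, mul_assoc (b i), ← key i j hij]
    congr 1
    rw [mul_assoc, ← mul_assoc (carry a j _), carry_mul_carry a hij (hni j),
      ← mul_assoc (carry a (n i) _), carry_mul_carry a (hni i) (hn.monotone hij)]
  · intro k x
    refine (Module.DirectLimit.lift_of (R := Aᵐᵒᵖ) (G := fun _ : ℕ => A)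
      (f := fun i j _ => leftMul (carry a i j)) g _ x).trans ?_
    rw [hg, mul_assoc, key k (n k) (hni k)]

/-- Intertwined sequences have isomorphic limits. -/
theorem Lim.exists_equiv {a a' : ℕ → A} {n m : ℕ → ℕ} (hn : StrictMono n) (hm : StrictMono m)
    {b c : ℕ → A} (hcb : ∀ k, c k * b k = carry a (n k) (n (k + 1)))
    (hbc : ∀ k, b (k + 1) * c k = carry a' (m k) (m (k + 1))) :
    ∃ F : Lim a ≃ₗ[Aᵐᵒᵖ] Lim a', (∀ k x, F (Lim.of a (n k) x) = Lim.of a' (m k) (b k * x)) ∧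
      ∀ k x, F.symm (Lim.of a' (m k) x) = Lim.of a (n (k + 1)) (c k * x) := by
  obtain ⟨F, hF⟩ := Lim.exists_map hn hm hcb hbc
  -- The inverse is the same construction with the roles exchanged; since `c k` ends at level `n (k
  -- + 1)`, that index is shifted by one.
  obtain ⟨F', hF'⟩ := Lim.exists_map (a := a') (a' := a) (n := m) (m := fun k => n (k + 1)) hm
    (fun i j h => hn (Nat.succ_lt_succ h)) (b := c) (c := fun k => b (k + 1)) hbc
    (fun k => hcb (k + 1))
  refine ⟨LinearEquiv.ofLinearMap F F' ?_ ?_, hF, hF'⟩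
  · refine LinearMap.ext fun z => ?_
    obtain ⟨k, x, rfl⟩ := Lim.exists_of z
    rw [LinearMap.comp_apply, ← Lim.of_carry a' (hm.le_apply : k ≤ m k), hF', hF, ← mul_assoc, hbc,
      Lim.of_carry a' (hm.monotone (Nat.le_succ k))]
    rfl
  · refine LinearMap.ext fun z => ?_
    obtain ⟨k, x, rfl⟩ := Lim.exists_of z
    rw [LinearMap.comp_apply, ← Lim.of_carry a (hn.le_apply : k ≤ n k), hF, hF', ← mul_assoc, hcb,
      Lim.of_carry a (hn.monotone (Nat.le_succ k))]
    rfl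

end Limit

/-! ### The Grothendieck group as a limit -/

section Grothendieck

variable {H : Type} [PartialOrder H]

/-- Sums of endomorphisms in `ℤ[End H]`. -/
def IsPos (m : MonoidAlgebra ℤ (H →o H)) : Prop :=
  ∃ (R : Type) (_ : Fintype R) (f : R → H →o H), m = ∑ i, MonoidAlgebra.of ℤ (H →o H) (f i)

theorem HasType.isPos {ι κ : Type} [Fintype ι] [DecidableEq ι] [Fintype κ] [DecidableEq κ]
    {p : ι → H} {q : κ → H} {φ : alg p →ₙₐ[ℂ] alg q} {m : MonoidAlgebra ℤ (H →o H)}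
    (h : HasType φ m) : IsPos m := by
  obtain ⟨R, _, _, f, -, -, -, rfl⟩ := h
  exact ⟨R, inferInstance, f, rfl⟩

theorem isPos_one : IsPos (1 : MonoidAlgebra ℤ (H →o H)) :=
  ⟨Unit, inferInstance, fun _ => 1, by simp [MonoidAlgebra.one_def]⟩

theorem IsPos.mul {m n : MonoidAlgebra ℤ (H →o H)} (hm : IsPos m) (hn : IsPos n) :
    IsPos (m * n) := by
  obtain ⟨R, _, f, rfl⟩ := hm
  obtain ⟨R', _, f', rfl⟩ := hn
  refine ⟨R × R', inferInstance, fun i => f i.1 * f' i.2, ?_⟩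
  rw [Finset.sum_mul_sum, Fintype.sum_prod_type]
  simp only [map_mul]

theorem IsPos.add {m n : MonoidAlgebra ℤ (H →o H)} (hm : IsPos m) (hn : IsPos n) :
    IsPos (m + n) := by
  obtain ⟨R, _, f, rfl⟩ := hm
  obtain ⟨R', _, f', rfl⟩ := hn
  exact ⟨R ⊕ R', inferInstance, Sum.elim f f', by simp⟩

theorem isPos_zero : IsPos (0 : MonoidAlgebra ℤ (H →o H)) :=
  ⟨Empty, inferInstance, Empty.elim, by simp⟩

theorem isPos_carry {a : ℕ → MonoidAlgebra ℤ (H →o H)} (ha : ∀ k, IsPos (a k)) (k j : ℕ) :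
    IsPos (carry a k j) := by
  induction j with
  | zero => exact isPos_one
  | succ j ih =>
    rw [carry]
    split_ifs
    · exact (ha j).mul ih
    · exact isPos_one

theorem exists_isPos_sub (x : MonoidAlgebra ℤ (H →o H)) :
    ∃ m n, IsPos m ∧ IsPos n ∧ x = m - n := by
  have hpos : ∀ (n : ℕ) (g : H →o H), IsPos (n • MonoidAlgebra.of ℤ (H →o H) g) := fun n g =>
    ⟨Fin n, inferInstance, fun _ => g, by simp⟩
  induction x using MonoidAlgebra.induction_linear with
  | zero => exact ⟨0, 0, isPos_zero, isPos_zero, (sub_self 0).symm⟩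
  | add x y hx hy =>
    obtain ⟨m, n, hm, hn, rfl⟩ := hx
    obtain ⟨m', n', hm', hn', rfl⟩ := hy
    exact ⟨m + m', n + n', hm.add hm', hn.add hn', by abel⟩
  | single g b =>
    refine ⟨_, _, hpos b.toNat g, hpos (-b).toNat g, ?_⟩
    have h1 : MonoidAlgebra.single g b = b • MonoidAlgebra.of ℤ (H →o H) g := by
      simp [MonoidAlgebra.of_apply]
    rw [h1, ← natCast_zsmul, ← natCast_zsmul, ← sub_smul, Int.toNat_sub_toNat_neg]

theorem System.trans_self (S : System H) (k : ℕ) :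
    S.trans (le_refl k) = NonUnitalAlgHom.id ℂ (alg (S.p k)) :=
  Nat.leRec_self _ _

theorem System.trans_succ (S : System H) {k j : ℕ} (h : k ≤ j) :
    S.trans (h.trans (Nat.le_succ j)) = (S.map j).comp (S.trans h) :=
  Nat.leRec_succ _ _ h

/-- The maps of the system `S` have the types `a k`. -/
def System.HasTypes (S : System H) (a : ℕ → MonoidAlgebra ℤ (H →o H)) : Prop :=
  ∀ k, HasType (S.map k) (a k)

theorem System.HasTypes.trans {S : System H} {a : ℕ → MonoidAlgebra ℤ (H →o H)} (ha : S.HasTypes a)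
    {k j : ℕ} (h : k ≤ j) : HasType (S.trans h) (carry a k j) := by
  induction j, h using Nat.le_induction with
  | base =>
    rw [S.trans_self, carry_self]
    exact hasType_id _
  | succ j hj ih =>
    rw [S.trans_succ hj, carry_succ a hj]
    exact (ha j).comp ih

theorem System.HasTypes.stable {S : System H} {a : ℕ → MonoidAlgebra ℤ (H →o H)}
    (ha : S.HasTypes a) : S.stable.HasTypes a :=
  fun k => (ha k).ampMap _

theorem System.InF.exists_hasTypes [Nonempty H] {S : System H} (hS : S.InF) :
    ∃ a, S.HasTypes a := by
  choose a ha using fun k => (hS.2.2 k).exists_hasType (hS.2.1 k)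
  exact ⟨a, ha⟩

variable [Fintype H] [DecidableEq H]

theorem Rep.exists_hasType [Nonempty H] {S : System H} (r : Rep S) : ∃ m, HasType r.φ m :=
  r.reg.exists_hasType Function.surjective_id

theorem HasType.carried {S : System H} {a : ℕ → MonoidAlgebra ℤ (H →o H)} (ha : S.HasTypes a)
    {k n j N : ℕ} (hk : k ≤ j) (hn : n ≤ N) {φ : alg (id : H → H) →ₙₐ[ℂ] alg (amp (S.p k) n)}
    {m : MonoidAlgebra ℤ (H →o H)} (h : HasType φ m) :
    HasType ((HSystem.ampMap (S.trans hk) hn).comp φ) (carry a k j * m) :=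
  ((ha.trans hk).ampMap hn).comp h

/-- Conjugation by a unitary of the algebra keeps the type, so both carried maps have the same type
at the common stage. -/
theorem Rep.Equivalent.of_eq (hH : (SimpleGraph.fromRel (fun u v : H => u ≤ v)).Connected)
    {S : System H} {a : ℕ → MonoidAlgebra ℤ (H →o H)} (ha : S.HasTypes a) {r s : Rep S}
    {m m' : MonoidAlgebra ℤ (H →o H)} (hr : HasType r.φ m) (hs : HasType s.φ m')
    (h : r.Equivalent s) : Lim.of a r.k m = Lim.of a s.k m' := by
  obtain ⟨j, N, hak, han, hbk, hbn, u, hu, hu', he⟩ := h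
  have h1 := (hr.carried ha hak han).conj (ψ := (ampMap (S.trans hbk) hbn).comp s.φ) hu' hu he
  have h2 := h1.unique hH Function.surjective_id (hs.carried ha hbk hbn)
  rw [← Lim.of_carry a hak, h2, Lim.of_carry a hbk]

/-- Equality in the limit is equality of types at some finite stage, where equal types are unitarily
equivalent. -/
theorem Rep.equivalent_of_lim_eq {S : System H} {a : ℕ → MonoidAlgebra ℤ (H →o H)}
    (ha : S.HasTypes a) {r s : Rep S} {m m' : MonoidAlgebra ℤ (H →o H)} (hr : HasType r.φ m)
    (hs : HasType s.φ m') (h : Lim.of a r.k m = Lim.of a s.k m') : r.Equivalent s := by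
  obtain ⟨j, -, hrj, hsj, he⟩ := Lim.eventually_eq h 0
  have h1 := hr.carried ha hrj (le_max_left r.n s.n)
  have h2 := hs.carried ha hsj (le_max_right r.n s.n)
  rw [← he] at h2
  obtain ⟨u, hu, hu', hx⟩ := h1.exists_unitary h2
  exact ⟨j, max r.n s.n, hrj, le_max_left _ _, hsj, le_max_right _ _, u, hu', hu, hx⟩

theorem cls_eq_of_lim_eq {S : System H} {a : ℕ → MonoidAlgebra ℤ (H →o H)}
    (ha : S.HasTypes a) {r s : Rep S} {m m' : MonoidAlgebra ℤ (H →o H)} (hr : HasType r.φ m)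
    (hs : HasType s.φ m') (h : Lim.of a r.k m = Lim.of a s.k m') : cls r = cls s := by
  have h1 : (Quot.mk _ r : V S) = Quot.mk _ s := Quot.sound (Rep.equivalent_of_lim_eq ha hr hs h)
  rw [cls, cls, h1]

theorem cls_directSum {S : System H} {k n m : ℕ} {φ : alg (id : H → H) →ₙₐ[ℂ] alg (amp (S.p k) n)}
    {ψ : alg (id : H → H) →ₙₐ[ℂ] alg (amp (S.p k) m)}
    {χ : alg (id : H → H) →ₙₐ[ℂ] alg (amp (S.p k) (n + m))} (hφ : IsRegular φ) (hψ : IsRegular ψ)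
    (hχ : IsRegular χ) (h : IsDirectSum φ ψ χ) :
    cls (⟨k, n + m, χ, hχ⟩ : Rep S) = cls ⟨k, n, φ, hφ⟩ + cls ⟨k, m, ψ, hψ⟩ := by
  rw [← sub_eq_zero]
  exact (QuotientAddGroup.eq_zero_iff _).mpr
    (AddSubgroup.subset_closure ⟨k, n, m, φ, ψ, χ, hφ, hψ, hχ, h, rfl⟩)

theorem exists_cls_eq_add [Nonempty H] {S : System H} {a : ℕ → MonoidAlgebra ℤ (H →o H)}
    (ha : S.HasTypes a) (r s : Rep S) : ∃ t : Rep S, cls t = cls r + cls s := by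
  obtain ⟨m, hm⟩ := r.exists_hasType
  obtain ⟨m', hm'⟩ := s.exists_hasType
  have h1 := hm.carried ha (le_max_left r.k s.k) (le_refl r.n)
  have h2 := hm'.carried ha (le_max_right r.k s.k) (le_refl s.n)
  obtain ⟨⟨χ, hχ⟩, hall⟩ := h1.directSum h2
  refine ⟨⟨_, _, χ, (hall χ hχ).isRegular⟩, ?_⟩
  rw [cls_directSum h1.isRegular h2.isRegular _ hχ]
  congr 1
  · exact cls_eq_of_lim_eq ha h1 hm (Lim.of_carry a (le_max_left r.k s.k) m)
  · exact cls_eq_of_lim_eq ha h2 hm' (Lim.of_carry a (le_max_right r.k s.k) m')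

/-- Every positive element of the limit is the class of a map. -/
theorem exists_rep {S : System H} (hS : ∀ k, Function.Surjective (S.p k)) (k : ℕ)
    {m : MonoidAlgebra ℤ (H →o H)} (hm : IsPos m) :
    ∃ r : Rep S, r.k = k ∧ HasType r.φ m := by
  obtain ⟨R, _, f, rfl⟩ := hm
  obtain ⟨n, φ, hφ⟩ := exists_hasType_amp (p := (id : H → H)) (hS k) f
  exact ⟨⟨k, n, φ, hφ.isRegular⟩, rfl, hφ⟩

theorem exists_eq_cls_sub_cls [Nonempty H] {S : System H}
    (hS : ∀ k, Function.Surjective (S.p k)) {a : ℕ → MonoidAlgebra ℤ (H →o H)}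
    (ha : S.HasTypes a) (g : G S) : ∃ r s : Rep S, g = cls r - cls s := by
  obtain ⟨x, rfl⟩ := QuotientAddGroup.mk_surjective g
  induction x using FreeAbelianGroup.induction_on with
  | zero =>
    obtain ⟨r₀, -⟩ := exists_rep hS 0 isPos_zero
    exact ⟨r₀, r₀, by rw [sub_self]; rfl⟩
  | of v =>
    obtain ⟨r, rfl⟩ := Quot.exists_rep v
    -- A generator is written as `[r ⊕ r] - [r]`.
    obtain ⟨t, ht⟩ := exists_cls_eq_add ha r r
    exact ⟨t, r, by rw [ht, add_sub_cancel_right]; rfl⟩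
  | neg v ih =>
    obtain ⟨r, s, h⟩ := ih
    exact ⟨s, r, by rw [← neg_sub, ← h]; rfl⟩
  | add x y hx hy =>
    obtain ⟨r, s, h⟩ := hx
    obtain ⟨r', s', h'⟩ := hy
    obtain ⟨t, ht⟩ := exists_cls_eq_add ha r r'
    obtain ⟨t', ht'⟩ := exists_cls_eq_add ha s s'
    refine ⟨t, t', ?_⟩
    rw [ht, ht', QuotientAddGroup.mk_add, h, h']
    abel

/-- `Θ` identifies the Grothendieck group with the limit of the types. -/
def Identifies {S : System H} {a : ℕ → MonoidAlgebra ℤ (H →o H)} (Θ : G S ≃+ Lim a) : Prop :=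
  ∀ (r : Rep S) m, HasType r.φ m → Θ (cls r) = Lim.of a r.k m

/-- The Grothendieck group is the limit of the groups `ℤ[End H]`. -/
theorem exists_equiv_lim (hH : (SimpleGraph.fromRel (fun u v : H => u ≤ v)).Connected)
    {S : System H} (hS : ∀ k, Function.Surjective (S.p k)) {a : ℕ → MonoidAlgebra ℤ (H →o H)}
    (ha : S.HasTypes a) :
    ∃ Θ : G S ≃+ Lim a, Identifies Θ := by
  have := hH.nonempty
  choose τ hτ using fun r : Rep S => r.exists_hasType
  let t : V S → Lim a := Quot.lift (fun r => Lim.of a r.k (τ r))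
    fun r s h => h.of_eq hH ha (hτ r) (hτ s)
  have ht : ∀ (r : Rep S) m, HasType r.φ m → t (Quot.mk _ r) = Lim.of a r.k m := by
    intro r m hm
    rw [hm.unique hH Function.surjective_id (hτ r)]
  have hl : ∀ (r : Rep S) m, HasType r.φ m →
      FreeAbelianGroup.lift t (FreeAbelianGroup.of (Quot.mk _ r : V S)) = Lim.of a r.k m :=
    fun r m hm => (FreeAbelianGroup.lift_apply_of _ _).trans (ht r m hm)
  let F : G S →+ Lim a := QuotientAddGroup.lift _ (FreeAbelianGroup.lift t) (by
    rw [AddSubgroup.closure_le]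
    rintro _ ⟨k, n, m, φ, ψ, χ, hφ, hψ, hχ, hsum, rfl⟩
    have h1 := hτ ⟨k, n, φ, hφ⟩
    have h2 := hτ ⟨k, m, ψ, hψ⟩
    have h3 := (h1.directSum h2).2 χ hsum
    change FreeAbelianGroup.lift t (FreeAbelianGroup.of (_ : V S) -
      (FreeAbelianGroup.of (_ : V S) + FreeAbelianGroup.of (_ : V S))) = 0
    rw [map_sub, map_add]
    exact (congrArg₂ (· - ·) (hl ⟨k, n + m, χ, hχ⟩ _ h3)
      (congrArg₂ (· + ·) (hl _ _ h1) (hl _ _ h2))).trans (by rw [map_add, sub_self]))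
  have hF : ∀ (r : Rep S) m, HasType r.φ m → F (cls r) = Lim.of a r.k m := by
    intro r m hm
    exact hl r m hm
  refine ⟨AddEquiv.ofBijective F ⟨?_, ?_⟩, hF⟩
  -- A group element is a difference of classes, and two maps with the same value in the limit
  -- already have the same class.
  · rw [injective_iff_map_eq_zero]
    intro g hg
    obtain ⟨r, s, rfl⟩ := exists_eq_cls_sub_cls hS ha g
    rw [map_sub, hF r _ (hτ r), hF s _ (hτ s), sub_eq_zero] at hg
    rw [cls_eq_of_lim_eq ha (hτ r) (hτ s) hg, sub_self]
  · intro z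
    obtain ⟨k, x, rfl⟩ := Lim.exists_of z
    obtain ⟨m, n, hm, hn, rfl⟩ := exists_isPos_sub x
    obtain ⟨r, rfl, hr⟩ := exists_rep hS k hm
    obtain ⟨s, hs, hs'⟩ := exists_rep hS r.k hn
    refine ⟨cls r - cls s, ?_⟩
    rw [map_sub, map_sub, hF r m hr, hF s n hs', hs]

end Grothendieck

/-! ### Isomorphisms of limits and regular isomorphisms -/

section Intertwining

variable {H : Type} [PartialOrder H]

/-- The positive cone of the limit. -/
def posLim (a : ℕ → MonoidAlgebra ℤ (H →o H)) : Set (Lim a) :=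
  {z | ∃ k m, IsPos m ∧ Lim.of a k m = z}

/-- The limits are isomorphic as ordered right modules over `ℤ[End H]`. -/
def LimIso (a a' : ℕ → MonoidAlgebra ℤ (H →o H)) : Prop :=
  ∃ γ : Lim a ≃ₗ[(MonoidAlgebra ℤ (H →o H))ᵐᵒᵖ] Lim a',
    (∀ z ∈ posLim a, γ z ∈ posLim a') ∧ ∀ z ∈ posLim a', γ.symm z ∈ posLim a

theorem amp_surjective {ι : Type} {p : ι → H} (hp : Function.Surjective p) (n : ℕ) :
    Function.Surjective (amp p (n + 1)) := fun u => by
  obtain ⟨x, hx⟩ := hp u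
  exact ⟨(x, 0), hx⟩

/-- The algebras of a stable system are large enough for all positive types. -/
theorem exists_hasType_stable {S : System H} (hS : ∀ k, Function.Surjective (S.p k))
    {a : ℕ → MonoidAlgebra ℤ (H →o H)} (ha : S.HasTypes a) {ι : Type} [Fintype ι] [DecidableEq ι]
    (p : ι → H) (k : ℕ) {m : MonoidAlgebra ℤ (H →o H)} (hm : IsPos m) :
    ∃ j, k ≤ j ∧ ∃ φ : alg p →ₙₐ[ℂ] alg (S.stable.p j), HasType φ (carry a k j * m) := by
  obtain ⟨R, _, f, rfl⟩ := hm
  obtain ⟨n, φ, hφ⟩ := exists_hasType_amp (p := p) (hS k) f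
  -- Stage `j` of the stable system carries `M_{j+1}`, so stage `max k n` has room for the `n`-fold
  -- amplification.
  have hn : n ≤ max k n + 1 := (le_max_right k n).trans (Nat.le_succ _)
  exact ⟨max k n, le_max_left k n, (ampMap (S.trans (le_max_left k n)) hn).comp φ,
    ((ha.trans (le_max_left k n)).ampMap hn).comp hφ⟩

/-- A map of the given class in the limit, and the commuting triangle with a map
in the other direction. -/
theorem exists_backward {S T : System H} (hS : ∀ k, Function.Surjective (S.p k))
    {a a' : ℕ → MonoidAlgebra ℤ (H →o H)} (ha : S.HasTypes a)
    (γ : Lim a ≃ₗ[(MonoidAlgebra ℤ (H →o H))ᵐᵒᵖ] Lim a') (hγ : ∀ z ∈ posLim a', γ.symm z ∈ posLim a)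
    {n m : ℕ} {φ : alg (S.stable.p n) →ₙₐ[ℂ] alg (T.p m)} {b : MonoidAlgebra ℤ (H →o H)}
    (hφ : HasType φ b) (hb : γ (Lim.of a n 1) = Lim.of a' m b) :
    ∃ (n' : ℕ) (h : n < n') (ψ : alg (T.p m) →ₙₐ[ℂ] alg (S.stable.p n'))
      (c : MonoidAlgebra ℤ (H →o H)), HasType ψ c ∧ ψ.comp φ = S.stable.trans h.le ∧
      γ.symm (Lim.of a' m 1) = Lim.of a n' c := by
  obtain ⟨k, c, hc, hcγ⟩ := hγ _ ⟨m, 1, isPos_one, rfl⟩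
  obtain ⟨j, hkj, ψ, hψ⟩ := exists_hasType_stable hS ha (T.p m) k hc
  set c' := carry a k j * c with hc'
  have h1 : Lim.of a j c' = γ.symm (Lim.of a' m 1) := by rw [hc', Lim.of_carry a hkj, hcγ]
  -- Linearity of `γ` enters here: `[c' b] = [c'] · b = γ⁻¹([1] · b) = γ⁻¹[b] = [1]`.
  have h2 : Lim.of a j (c' * b) = Lim.of a n 1 := by
    rw [Lim.of_mul, h1, ← map_smul, ← Lim.of_mul, one_mul, ← hb, LinearEquiv.symm_apply_apply]
  -- The bound `n + 1` makes `n < n'`. At stage `n'` the composed map and the map of the system have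
  -- the same type; a unitary then makes the triangle commute exactly.
  obtain ⟨n', hn', hjn', hnn', he⟩ := Lim.eventually_eq h2 (n + 1)
  have h3 := (ha.stable.trans hjn').comp hψ
  have h4 := h3.comp hφ
  have h5 := ha.stable.trans hnn'
  rw [mul_assoc, he, mul_one] at h4
  obtain ⟨u, hu, huq, hconj⟩ := h4.exists_unitary h5
  obtain ⟨ψ', hψ', hψu⟩ := h3.exists_conj hu huq
  refine ⟨n', hn', ψ', _, hψ', ?_, ?_⟩
  · ext1 x
    apply Subtype.ext
    rw [NonUnitalAlgHom.comp_apply, ← hψu, ← hconj]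
    rfl
  · rw [Lim.of_carry a hjn', h1]

/-- A stage `A_n → A'_m` of the intertwining of two systems. -/
structure Stage (S T : System H) {a a' : ℕ → MonoidAlgebra ℤ (H →o H)}
    (γ : Lim a ≃ₗ[(MonoidAlgebra ℤ (H →o H))ᵐᵒᵖ] Lim a') where
  n : ℕ
  m : ℕ
  φ : alg (S.p n) →ₙₐ[ℂ] alg (T.p m)
  b : MonoidAlgebra ℤ (H →o H)
  hasType : HasType φ b
  map_eq : γ (Lim.of a n 1) = Lim.of a' m b

/-- The stage `t` extends the stage `s` by two commuting triangles. -/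
def Stage.Next {S T : System H} {a a' : ℕ → MonoidAlgebra ℤ (H →o H)}
    {γ : Lim a ≃ₗ[(MonoidAlgebra ℤ (H →o H))ᵐᵒᵖ] Lim a'} (s t : Stage S T γ) : Prop :=
  ∃ (hn : s.n < t.n) (hm : s.m < t.m) (ψ : alg (T.p s.m) →ₙₐ[ℂ] alg (S.p t.n)),
    IsRegular ψ ∧ ψ.comp s.φ = S.trans hn.le ∧ t.φ.comp ψ = T.trans hm.le

theorem regIso_of_next {S T : System H} {a a' : ℕ → MonoidAlgebra ℤ (H →o H)}
    {γ : Lim a ≃ₗ[(MonoidAlgebra ℤ (H →o H))ᵐᵒᵖ] Lim a'} (s₀ : Stage S T γ) (h₀ : s₀.n = 0)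
    (hnext : ∀ s : Stage S T γ, ∃ t, s.Next t) : RegIso S T := by
  choose next hnext using hnext
  let s : ℕ → Stage S T γ := fun k => Nat.rec s₀ (fun _ s => next s) k
  have hs : ∀ k, (s k).Next (s (k + 1)) := fun k => hnext (s k)
  choose hn hm ψ hψ h1 h2 using hs
  exact ⟨fun k => (s k).n, fun k => (s k).m, strictMono_nat_of_lt_succ hn,
    strictMono_nat_of_lt_succ hm, fun k => (s k).φ, ψ, h₀, fun k => (s k).hasType.isRegular, hψ,
    h1, h2⟩

theorem LimIso.stablyRegIso {S T : System H} (hS : ∀ k, Function.Surjective (S.p k))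
    (hT : ∀ k, Function.Surjective (T.p k)) {a a' : ℕ → MonoidAlgebra ℤ (H →o H)}
    (ha : S.HasTypes a) (ha' : T.HasTypes a') (h : LimIso a a') : StablyRegIso S T := by
  obtain ⟨γ, hγ, hγ'⟩ := h
  obtain ⟨k, b, hb, hbγ⟩ := hγ _ ⟨0, 1, isPos_one, rfl⟩
  obtain ⟨j, hkj, φ, hφ⟩ := exists_hasType_stable hT ha' (S.stable.p 0) k hb
  refine regIso_of_next (γ := γ)
    ⟨0, j, φ, _, hφ, by rw [Lim.of_carry a' hkj, hbγ]⟩ rfl fun s => ?_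
  obtain ⟨n', hn', ψ, c, hψ, hψφ, hc⟩ := exists_backward (T := T.stable) hS ha γ hγ' s.hasType
    s.map_eq
  -- The second triangle is the first one for `γ.symm`, with `ψ` as the given map.
  obtain ⟨m', hm', φ', b', hφ', hφψ, hb'⟩ := exists_backward (T := S.stable) hT ha' γ.symm hγ hψ hc
  exact ⟨⟨n', m', φ', b', hφ', hb'⟩, hn', hm', ψ, hψ.isRegular, hψφ, hφψ⟩

/-- By uniqueness of types the commuting triangles become equations between types. These intertwine
the two sequences by positive elements, so both directions preserve the cones. -/
theorem RegIso.limIso (hH : (SimpleGraph.fromRel (fun u v : H => u ≤ v)).Connected)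
    {S T : System H} (hS : ∀ k, Function.Surjective (S.p k))
    (hT : ∀ k, Function.Surjective (T.p k)) {a a' : ℕ → MonoidAlgebra ℤ (H →o H)}
    (ha : S.HasTypes a) (ha' : T.HasTypes a') (h : RegIso S T) : LimIso a a' := by
  have := hH.nonempty
  obtain ⟨n, m, hn, hm, φ, ψ, -, hφ, hψ, h1, h2⟩ := h
  choose b hb using fun k => (hφ k).exists_hasType (hS (n k))
  choose c hc using fun k => (hψ k).exists_hasType (hT (m k))
  obtain ⟨γ, hγ, hγ'⟩ := Lim.exists_equiv (a := a) (a' := a') hn hm (b := b) (c := c)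
    (fun k => by
      have h3 := (hc k).comp (hb k)
      rw [h1] at h3
      exact h3.unique hH (hS _) (ha.trans _))
    (fun k => by
      have h3 := (hb (k + 1)).comp (hc k)
      rw [h2] at h3
      exact h3.unique hH (hT _) (ha'.trans _))
  refine ⟨γ, ?_, ?_⟩
  · rintro _ ⟨k, x, hx, rfl⟩
    rw [← Lim.of_carry a (hn.le_apply : k ≤ n k), hγ]
    exact ⟨_, _, (hb k).isPos.mul ((isPos_carry (fun i => (ha i).isPos) _ _).mul hx), rfl⟩
  · rintro _ ⟨k, x, hx, rfl⟩
    rw [← Lim.of_carry a' (hm.le_apply : k ≤ m k), hγ']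
    exact ⟨_, _, (hc k).isPos.mul ((isPos_carry (fun i => (ha' i).isPos) _ _).mul hx), rfl⟩

end Intertwining

/-! ### Isomorphisms of limits and of Grothendieck groups -/

section Groups

variable {H : Type} [PartialOrder H] [Fintype H] [DecidableEq H]

/-- The tuple of a map is the orbit of its class under the right action of `End H`, because `φ ∘
θ_f` has the type of `φ` times `f`. -/
theorem Identifies.isMultiClass_iff {S : System H} {a : ℕ → MonoidAlgebra ℤ (H →o H)}
    {Θ : G S ≃+ Lim a} (hΘ : Identifies Θ) {r : Rep S} {m : MonoidAlgebra ℤ (H →o H)}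
    (hr : HasType r.φ m) (g : (H →o H) → G S) :
    IsMultiClass r g ↔ ∀ f, Θ (g f) =
      MulOpposite.op (MonoidAlgebra.of ℤ (H →o H) f) • Lim.of a r.k m := by
  refine forall_congr' fun f => ?_
  have hreg := (hr.compTheta f).isRegular
  have h1 : Θ (cls ⟨r.k, r.n * Fintype.card H, compTheta r.φ f, hreg⟩) =
      MulOpposite.op (MonoidAlgebra.of ℤ (H →o H) f) • Lim.of a r.k m := by
    rw [← Lim.of_mul]
    exact hΘ _ _ (hr.compTheta f)
  rw [← h1]
  exact ⟨fun ⟨_, h⟩ => by rw [h], fun h => ⟨hreg, Θ.injective h⟩⟩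

/-- The reps in `X` exhaust the positive cone of the limit. -/
def Exhausts {S : System H} (a : ℕ → MonoidAlgebra ℤ (H →o H)) (X : Rep S → Prop) : Prop :=
  ∀ z ∈ posLim a, ∃ r, X r ∧ ∃ m, HasType r.φ m ∧ Lim.of a r.k m = z

theorem exhausts_true {S : System H} (hS : ∀ k, Function.Surjective (S.p k))
    (a : ℕ → MonoidAlgebra ℤ (H →o H)) : Exhausts (S := S) a fun _ => True := by
  rintro _ ⟨k, m, hm, rfl⟩
  obtain ⟨r, rfl, hr⟩ := exists_rep hS k hm
  exact ⟨r, trivial, m, hr, rfl⟩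

/-- In a stable system the scale is the whole cone, and the multiscale the whole multicone. -/
theorem exhausts_stable {S : System H} (hS : ∀ k, Function.Surjective (S.p k))
    {a : ℕ → MonoidAlgebra ℤ (H →o H)} (ha : S.HasTypes a) :
    Exhausts (S := S.stable) a fun r => r.n = 1 := by
  rintro _ ⟨k, m, hm, rfl⟩
  obtain ⟨j, hkj, φ, hφ⟩ := exists_hasType_stable hS ha (id : H → H) k hm
  obtain ⟨i, hi⟩ := exists_hasType_amp_one (S.stable.p j)
  have h1 := hi.comp hφ
  rw [one_mul] at h1
  exact ⟨⟨j, 1, i.comp φ, h1.isRegular⟩, rfl, _, h1, Lim.of_carry a hkj m⟩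

theorem exists_rep_image [Nonempty H] {S T : System H} {a a' : ℕ → MonoidAlgebra ℤ (H →o H)}
    {Θ : G S ≃+ Lim a} (hΘ : Identifies Θ) {Θ' : G T ≃+ Lim a'} (hΘ' : Identifies Θ')
    {γ : Lim a ≃ₗ[(MonoidAlgebra ℤ (H →o H))ᵐᵒᵖ] Lim a'} (hγ : ∀ z ∈ posLim a, γ z ∈ posLim a')
    {δ : G S → G T} (hδ : ∀ g, Θ' (δ g) = γ (Θ g)) {X : Rep T → Prop} (hX : Exhausts a' X)
    (r : Rep S) : ∃ r' : Rep T, X r' ∧ δ (cls r) = cls r' ∧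
      ∀ g, IsMultiClass r g → IsMultiClass r' (fun f => δ (g f)) := by
  obtain ⟨m, hm⟩ := r.exists_hasType
  obtain ⟨r', hr', m', hm', he⟩ := hX _ (hγ _ ⟨r.k, m, hm.isPos, rfl⟩)
  refine ⟨r', hr', Θ'.injective ?_, fun g hg => ?_⟩
  · rw [hδ, hΘ _ _ hm, hΘ' _ _ hm', he]
  · rw [hΘ.isMultiClass_iff hm] at hg
    rw [hΘ'.isMultiClass_iff hm']
    intro f
    rw [hδ, hg, map_smul, he]

/-- Only exhaustion of the cone matters for `X` and `X'`, so cones and stable scales are treated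
together. Linearity of `γ` carries the tuple `(z · f)_f` to `(γ z · f)_f`. -/
theorem image_eq_of_limIso [Nonempty H] {S T : System H} {a a' : ℕ → MonoidAlgebra ℤ (H →o H)}
    {Θ : G S ≃+ Lim a} (hΘ : Identifies Θ) {Θ' : G T ≃+ Lim a'} (hΘ' : Identifies Θ')
    {γ : Lim a ≃ₗ[(MonoidAlgebra ℤ (H →o H))ᵐᵒᵖ] Lim a'} (hγ : ∀ z ∈ posLim a, γ z ∈ posLim a')
    (hγ' : ∀ z ∈ posLim a', γ.symm z ∈ posLim a) {δ : G S ≃+ G T}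
    (hδ : ∀ g, Θ' (δ g) = γ (Θ g)) {X : Rep S → Prop} {X' : Rep T → Prop} (hX : Exhausts a X)
    (hX' : Exhausts a' X') :
    δ '' {g | ∃ r, X r ∧ g = cls r} = {g | ∃ r, X' r ∧ g = cls r} ∧
    (fun (g : (H →o H) → G S) f => δ (g f)) '' {g | ∃ r, X r ∧ IsMultiClass r g} =
      {g | ∃ r, X' r ∧ IsMultiClass r g} := by
  have hδ' : ∀ g, Θ (δ.symm g) = γ.symm (Θ' g) := by
    intro g
    rw [LinearEquiv.eq_symm_apply, ← hδ, AddEquiv.apply_symm_apply]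
  constructor
  · apply Set.Subset.antisymm
    · rintro _ ⟨_, ⟨r, -, rfl⟩, rfl⟩
      obtain ⟨r', hr', h, -⟩ := exists_rep_image hΘ hΘ' hγ hδ hX' r
      exact ⟨r', hr', h⟩
    · rintro _ ⟨r, -, rfl⟩
      obtain ⟨r', hr', h, -⟩ := exists_rep_image hΘ' hΘ hγ' hδ' hX r
      exact ⟨cls r', ⟨r', hr', rfl⟩, by rw [← h, AddEquiv.apply_symm_apply]⟩
  · apply Set.Subset.antisymm
    · rintro _ ⟨g, ⟨r, -, hg⟩, rfl⟩
      obtain ⟨r', hr', -, h⟩ := exists_rep_image hΘ hΘ' hγ hδ hX' r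
      exact ⟨r', hr', h g hg⟩
    · rintro g ⟨r, -, hg⟩
      obtain ⟨r', hr', -, h⟩ := exists_rep_image hΘ' hΘ hγ' hδ' hX r
      exact ⟨_, ⟨r', hr', h g hg⟩, funext fun f => AddEquiv.apply_symm_apply _ _⟩

theorem posCone_eq (S : System H) : posCone S = {g | ∃ r : Rep S, True ∧ g = cls r} := by
  ext g
  exact ⟨fun ⟨r, h⟩ => ⟨r, trivial, h.symm⟩, fun ⟨r, _, h⟩ => ⟨r, h.symm⟩⟩

theorem multicone_eq (S : System H) :
    multicone S = {g | ∃ r : Rep S, True ∧ IsMultiClass r g} := by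
  ext g
  exact ⟨fun ⟨r, h⟩ => ⟨r, trivial, h⟩, fun ⟨r, _, h⟩ => ⟨r, h⟩⟩

theorem LimIso.multiconeIso (hH : (SimpleGraph.fromRel (fun u v : H => u ≤ v)).Connected)
    {S T : System H} (hS : ∀ k, Function.Surjective (S.p k))
    (hT : ∀ k, Function.Surjective (T.p k)) {a a' : ℕ → MonoidAlgebra ℤ (H →o H)}
    (ha : S.HasTypes a) (ha' : T.HasTypes a') (h : LimIso a a') : MulticoneIso S T := by
  have := hH.nonempty
  obtain ⟨γ, hγ, hγ'⟩ := h
  obtain ⟨Θ, hΘ⟩ := exists_equiv_lim hH hS ha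
  obtain ⟨Θ', hΘ'⟩ := exists_equiv_lim hH hT ha'
  obtain ⟨h1, h2⟩ := image_eq_of_limIso (δ := (Θ.trans γ.toAddEquiv).trans Θ'.symm) hΘ hΘ' hγ hγ'
    (fun g => Θ'.apply_symm_apply _) (exhausts_true hS a) (exhausts_true hT a')
  refine ⟨(Θ.trans γ.toAddEquiv).trans Θ'.symm, ?_, ?_⟩
  · rw [posCone_eq, posCone_eq]
    exact h1
  · rw [multicone_eq, multicone_eq]
    exact h2

theorem LimIso.multiscaleIso_stable
    (hH : (SimpleGraph.fromRel (fun u v : H => u ≤ v)).Connected)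
    {S T : System H} (hS : ∀ k, Function.Surjective (S.p k))
    (hT : ∀ k, Function.Surjective (T.p k)) {a a' : ℕ → MonoidAlgebra ℤ (H →o H)}
    (ha : S.HasTypes a) (ha' : T.HasTypes a') (h : LimIso a a') :
    MultiscaleIso S.stable T.stable := by
  have := hH.nonempty
  obtain ⟨γ, hγ, hγ'⟩ := h
  have hS' : ∀ k, Function.Surjective (S.stable.p k) := fun k => amp_surjective (hS k) k
  have hT' : ∀ k, Function.Surjective (T.stable.p k) := fun k => amp_surjective (hT k) k
  obtain ⟨Θ, hΘ⟩ := exists_equiv_lim hH hS' ha.stable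
  obtain ⟨Θ', hΘ'⟩ := exists_equiv_lim hH hT' ha'.stable
  obtain ⟨h1, -⟩ := image_eq_of_limIso (δ := (Θ.trans γ.toAddEquiv).trans Θ'.symm) hΘ hΘ' hγ hγ'
    (fun g => Θ'.apply_symm_apply _) (exhausts_true hS' a) (exhausts_true hT' a')
  obtain ⟨h2, h3⟩ := image_eq_of_limIso (δ := (Θ.trans γ.toAddEquiv).trans Θ'.symm) hΘ hΘ' hγ hγ'
    (fun g => Θ'.apply_symm_apply _) (exhausts_stable hS ha) (exhausts_stable hT ha')
  refine ⟨_, ?_, h2, h3⟩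
  rw [posCone_eq, posCone_eq]
  exact h1

theorem map_posLim [Nonempty H] {S T : System H} (hS : ∀ k, Function.Surjective (S.p k))
    {a a' : ℕ → MonoidAlgebra ℤ (H →o H)} {Θ : G S ≃+ Lim a} (hΘ : Identifies Θ)
    {Θ' : G T ≃+ Lim a'} (hΘ' : Identifies Θ') {δ : G S → G T}
    (hδ : ∀ r : Rep S, δ (cls r) ∈ posCone T) (z : Lim a) (hz : z ∈ posLim a) :
    Θ' (δ (Θ.symm z)) ∈ posLim a' := by
  obtain ⟨r, -, m, hm, rfl⟩ := exhausts_true (S := S) hS a z hz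
  rw [← hΘ r m hm, AddEquiv.symm_apply_apply]
  obtain ⟨r', hr'⟩ := hδ r
  obtain ⟨m', hm'⟩ := r'.exists_hasType
  rw [← hr', hΘ' _ _ hm']
  exact ⟨_, _, hm'.isPos, rfl⟩

/-- An additive map of limits that commutes with the endomorphisms on the generators is linear. -/
theorem map_smul_of_map_of {a a' : ℕ → MonoidAlgebra ℤ (H →o H)} (γ : Lim a →+ Lim a')
    (h : ∀ k f, γ (Lim.of a k (MonoidAlgebra.of ℤ (H →o H) f)) =
      MulOpposite.op (MonoidAlgebra.of ℤ (H →o H) f) • γ (Lim.of a k 1))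
    (c : (MonoidAlgebra ℤ (H →o H))ᵐᵒᵖ) (z : Lim a) : γ (c • z) = c • γ z := by
  have h1 : ∀ k x, γ (Lim.of a k x) = MulOpposite.op x • γ (Lim.of a k 1) := by
    intro k x
    induction x using MonoidAlgebra.induction_linear with
    | zero => simp
    | add x y hx hy => rw [map_add, map_add, hx, hy, MulOpposite.op_add, add_smul]
    | single g b =>
      have h2 : MonoidAlgebra.single g b = b • MonoidAlgebra.of ℤ (H →o H) g := by
        simp [MonoidAlgebra.of_apply]
      rw [h2, map_zsmul, map_zsmul, h, MulOpposite.op_smul, smul_assoc]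
  obtain ⟨k, x, rfl⟩ := Lim.exists_of z
  obtain ⟨y, rfl⟩ := MulOpposite.op_surjective c
  rw [← Lim.of_mul, h1, h1 k x, MulOpposite.op_mul, mul_smul]

/-- At level `k` a map of identity type has the tuple `([f])_f`. Its image is again a tuple `(z ·
f)_f`, which says that the isomorphism is linear on the generators `[1]`. Since the identity type
fits into `A_k ⊗ M_1`, tuples of the multiscale suffice. -/
theorem limIso_of_addEquiv (hH : (SimpleGraph.fromRel (fun u v : H => u ≤ v)).Connected)
    {S T : System H} (hS : ∀ k, Function.Surjective (S.p k))
    (hT : ∀ k, Function.Surjective (T.p k)) {a a' : ℕ → MonoidAlgebra ℤ (H →o H)}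
    (ha : S.HasTypes a) (ha' : T.HasTypes a') (δ : G S ≃+ G T) (hpos : δ '' posCone S = posCone T)
    (hδ : ∀ r : Rep S, r.n = 1 → ∀ g, IsMultiClass r g →
      ∃ r' : Rep T, IsMultiClass r' (fun f => δ (g f))) : LimIso a a' := by
  have := hH.nonempty
  obtain ⟨Θ, hΘ⟩ := exists_equiv_lim hH hS ha
  obtain ⟨Θ', hΘ'⟩ := exists_equiv_lim hH hT ha'
  let γ : Lim a ≃+ Lim a' := (Θ.symm.trans δ).trans Θ'
  have hγ : ∀ z, γ z = Θ' (δ (Θ.symm z)) := fun _ => rfl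
  have key : ∀ k f, γ (Lim.of a k (MonoidAlgebra.of ℤ (H →o H) f)) =
      MulOpposite.op (MonoidAlgebra.of ℤ (H →o H) f) • γ (Lim.of a k 1) := by
    intro k
    obtain ⟨φ, hφ⟩ := exists_hasType_one (hS k)
    let r : Rep S := ⟨k, 1, φ, hφ.isRegular⟩
    let g : (H →o H) → G S := fun f => Θ.symm (Lim.of a k (MonoidAlgebra.of ℤ (H →o H) f))
    have hg : IsMultiClass r g := by
      rw [Identifies.isMultiClass_iff hΘ (r := r) hφ]
      intro f
      rw [← Lim.of_mul, one_mul]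
      exact Θ.apply_symm_apply _
    obtain ⟨r', hr'⟩ := hδ r rfl g hg
    obtain ⟨m, hm⟩ := r'.exists_hasType
    rw [Identifies.isMultiClass_iff hΘ' hm] at hr'
    -- The coordinate at the identity endomorphism gives the class itself.
    have h1 : γ (Lim.of a k 1) = Lim.of a' r'.k m := by
      have h2 := hr' 1
      rw [map_one, MulOpposite.op_one, one_smul] at h2
      rw [← h2, ← map_one (MonoidAlgebra.of ℤ (H →o H))]
      rfl
    intro f
    rw [h1, ← hr' f]
    rfl
  refine ⟨{ γ with map_smul' := map_smul_of_map_of γ.toAddMonoidHom key }, ?_, ?_⟩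
  · exact map_posLim hS hΘ hΘ' fun r => hpos ▸ ⟨_, ⟨r, rfl⟩, rfl⟩
  · refine map_posLim (δ := δ.symm) hT hΘ' hΘ fun r => ?_
    obtain ⟨g, hg, hgr⟩ : cls r ∈ δ '' posCone S := hpos ▸ ⟨r, rfl⟩
    rw [← hgr, AddEquiv.symm_apply_apply]
    exact hg

theorem MulticoneIso.limIso (hH : (SimpleGraph.fromRel (fun u v : H => u ≤ v)).Connected)
    {S T : System H} (hS : ∀ k, Function.Surjective (S.p k))
    (hT : ∀ k, Function.Surjective (T.p k)) {a a' : ℕ → MonoidAlgebra ℤ (H →o H)}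
    (ha : S.HasTypes a) (ha' : T.HasTypes a') (h : MulticoneIso S T) : LimIso a a' := by
  obtain ⟨δ, hpos, hm⟩ := h
  refine limIso_of_addEquiv hH hS hT ha ha' δ hpos fun r _ g hg => ?_
  have h1 : (fun f => δ (g f)) ∈ multicone T := hm ▸ ⟨g, ⟨r, hg⟩, rfl⟩
  exact h1

theorem MultiscaleIso.limIso (hH : (SimpleGraph.fromRel (fun u v : H => u ≤ v)).Connected)
    {S T : System H} (hS : ∀ k, Function.Surjective (S.p k))
    (hT : ∀ k, Function.Surjective (T.p k)) {a a' : ℕ → MonoidAlgebra ℤ (H →o H)}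
    (ha : S.HasTypes a) (ha' : T.HasTypes a') (h : MultiscaleIso S T) : LimIso a a' := by
  obtain ⟨δ, hpos, -, hm⟩ := h
  refine limIso_of_addEquiv hH hS hT ha ha' δ hpos fun r hr g hg => ?_
  have h1 : (fun f => δ (g f)) ∈ multiscale T := hm ▸ ⟨g, ⟨r, hr, hg⟩, rfl⟩
  obtain ⟨r', -, h2⟩ := h1
  exact ⟨r', h2⟩

end Groups

end HSystem

end

theorem theorem4p3 (H : Type) [Fintype H] [DecidableEq H] [PartialOrder H]
    (hH : (SimpleGraph.fromRel (fun u v : H => u ≤ v)).Connected)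
    (A A' : HSystem.System H) (hA : A.InF) (hA' : A'.InF) :
    (HSystem.StablyRegIso A A' ↔ HSystem.MultiscaleIso A.stable A'.stable) ∧
    (HSystem.StablyRegIso A A' ↔ HSystem.MulticoneIso A A') ∧
    (HSystem.MultiscaleIso A A' → HSystem.StablyRegIso A A') := by
  have := hH.nonempty
  obtain ⟨a, ha⟩ := hA.exists_hasTypes
  obtain ⟨a', ha'⟩ := hA'.exists_hasTypes
  have hS : ∀ k, Function.Surjective (A.stable.p k) :=
    fun k => HSystem.amp_surjective (hA.2.1 k) k
  have hS' : ∀ k, Function.Surjective (A'.stable.p k) :=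
    fun k => HSystem.amp_surjective (hA'.2.1 k) k
  have h1 : HSystem.StablyRegIso A A' → HSystem.LimIso a a' :=
    fun h => HSystem.RegIso.limIso hH hS hS' ha.stable ha'.stable h
  have h2 : HSystem.LimIso a a' → HSystem.StablyRegIso A A' :=
    fun h => h.stablyRegIso hA.2.1 hA'.2.1 ha ha'
  refine ⟨⟨fun h => (h1 h).multiscaleIso_stable hH hA.2.1 hA'.2.1 ha ha', fun h => h2 ?_⟩,
    ⟨fun h => (h1 h).multiconeIso hH hA.2.1 hA'.2.1 ha ha', fun h => h2 ?_⟩, fun h => h2 ?_⟩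
  · exact h.limIso hH hS hS' ha.stable ha'.stable
  · exact h.limIso hH hA.2.1 hA'.2.1 ha ha'
  · exact h.limIso hH hA.2.1 hA'.2.1 ha ha'
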